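/- Let $\mathbb{N}=\{1,2,\dots\}$. For every $k\in\mathbb{N}$ let $\{Z_k(t)\}_{t\in\mathbb{N}}$ be a centered Gaussian process with unit variances and non-negative correlation function $A_k(s,t)=\mathbb{E}[Z_k(s)Z_k(t)]\ge 0$, and let $\{Z_\infty(t)\}_{t\in\mathbb{N}}$ be a stationary centered Gaussian process with unit variance and non-negative correlation function $A_\infty(\tau)=\mathbb{E}[Z_\infty(s)Z_\infty(s+\tau)]\ge 0$ (the processes may live on different probability spaces). Assume that, for every $\tau\in\{0,1,2,\dots\}$, $A_k(s,s+\tau)\to A_\infty(\tau)$ as $k\to\infty$, uniformly in $s\in\mathbb{N}$. Suppose further that, with $g_k(\tau):=\sup_{s\in\mathbb{N}}A_k(s,s+\tau)$, $$\lim_{L\to\infty}\limsup_{k\to\infty}\sum_{i=L}^\infty g_k(i)=0 .$$ Then for every $r\in\mathbb{R}$ the probabilities $\mathbb{P}(\sup_{1\le i\le n}Z_k(i)<r)$ and $\mathbb{P}(\sup_{1\le i\le n}Z_\infty(i)<r)$ are positive for all $k,n\in\mathbb{N}$, and $$\limsup_{k,n\to\infty}\frac1n\Big|\log\mathbb{P}\Big(\sup_{1\le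 i\le n}Z_k(i)<r\Big)-\log\mathbb{P}\Big(\sup_{1\le i\le n}Z_\infty(i)<r\Big)\Big|=0,$$ where $k$ and $n$ tend to infinity jointly, independently of each other. -/

import Mathlib

open MeasureTheory ProbabilityTheory Filter Topology
open scoped ENNReal

namespace Persistence

/-- The time `s + τ`, for a time `s ∈ {1, 2, …}` and a lag `τ ∈ {0, 1, 2, …}`. -/
def shift (s : ℕ+) (τ : ℕ) : ℕ+ := ⟨(s : ℕ) + τ, Nat.add_pos_left s.pos τ⟩

/-- `Z = (Z(t))_{t ∈ {1, 2, …}}` is, under `P`, a centered Gaussian process with nonnegative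
correlation function `A(s, t)`. As usual for a process specified through its correlation function,
the process has unit variance, so that `A` is also its covariance function. -/
structure IsCenteredGaussianWithCorr {Ω : Type*} [MeasurableSpace Ω]
    (P : Measure Ω) (Z : ℕ+ → Ω → ℝ) (A : ℕ+ → ℕ+ → ℝ) : Prop where
  gaussian : IsGaussianProcess Z P
  centered : ∀ t, ∫ ω, Z t ω ∂P = 0
  unit_variance : ∀ t, variance (Z t) P = 1
  corr : ∀ s t, covariance (Z s) (Z t) P = A s t
  nonneg : ∀ s t, 0 ≤ A s t

/-- `Z = (Z(t))_{t ∈ {1, 2, …}}` is, under `P`, a stationary centered Gaussian process with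
nonnegative correlation function `A(τ)`: the correlation of `Z(s)` and `Z(t)` is `A(|s - t|)`.
A centered Gaussian process is (strictly) stationary if and only if its covariances are invariant
under time shifts. -/
def IsStationaryCenteredGaussianWithCorr {Ω : Type*} [MeasurableSpace Ω]
    (P : Measure Ω) (Z : ℕ+ → Ω → ℝ) (A : ℕ → ℝ) : Prop :=
  IsCenteredGaussianWithCorr P Z (fun s t => A (Nat.dist (s : ℕ) (t : ℕ)))

/-- The supremum over all `s` of the correlations `A(s, s + τ)` at lag `τ` (as an extended
nonnegative number, so that it can be summed over `τ` without convergence conventions). -/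
noncomputable def supCorr (A : ℕ+ → ℕ+ → ℝ) (τ : ℕ) : ℝ≥0∞ :=
  ⨆ s : ℕ+, ENNReal.ofReal (A s (shift s τ))

/-- The persistence probability `P(sup_{1 ≤ i ≤ n} Z(i) < r)`. -/
noncomputable def persistenceProb {Ω : Type*} [MeasurableSpace Ω]
    (P : Measure Ω) (Z : ℕ+ → Ω → ℝ) (r : ℝ) (n : ℕ) : ℝ :=
  P.real {ω | ∀ i : ℕ+, (i : ℕ) ≤ n → Z i ω < r}

end Persistence

set_option linter.unusedSectionVars false

namespace Persistence

open Matrix WithLp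

section Basics
variable {ι : Type*} [Fintype ι] [DecidableEq ι]

/-- The centered Gaussian probability, with covariance matrix `S`, of the orthant below `a`. -/
noncomputable def orthant (S : Matrix ι ι ℝ) (a : ι → ℝ) : ℝ :=
  (multivariateGaussian 0 S).real {x | ∀ i, x i < a i}

lemma measurableSet_orthant (a : ι → ℝ) :
    MeasurableSet {x : EuclideanSpace ℝ ι | ∀ i, x i < a i} := by
  have : {x : EuclideanSpace ℝ ι | ∀ i, x i < a i} = ⋂ i, {x | x i < a i} := by ext; simp
  rw [this]
  exact MeasurableSet.iInter fun i => measurableSet_lt (by fun_prop) measurable_const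

lemma orthant_nonneg (S : Matrix ι ι ℝ) (a : ι → ℝ) : 0 ≤ orthant S a := measureReal_nonneg

lemma orthant_mono (S : Matrix ι ι ℝ) {a b : ι → ℝ} (h : ∀ i, a i ≤ b i) :
    orthant S a ≤ orthant S b :=
  measureReal_mono fun _ hx i => (hx i).trans_le (h i)

lemma ofReal_orthant (S : Matrix ι ι ℝ) (a : ι → ℝ) :
    ENNReal.ofReal (orthant S a) = multivariateGaussian 0 S {x | ∀ i, x i < a i} := by
  simp [orthant]

lemma conv_multivariateGaussian {S T : Matrix ι ι ℝ} (hS : S.PosSemidef) (hT : T.PosSemidef) :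
    (multivariateGaussian 0 S) ∗ (multivariateGaussian 0 T) = multivariateGaussian 0 (S + T) := by
  apply Measure.ext_of_charFun
  ext x
  rw [charFun_conv, charFun_multivariateGaussian hS, charFun_multivariateGaussian hT,
    charFun_multivariateGaussian (hS.add hT), ← Complex.exp_add, Matrix.add_mulVec,
    dotProduct_add]
  congr 1
  push_cast
  simp
  ring

lemma multivariateGaussian_add_orthant {S T : Matrix ι ι ℝ} (hS : S.PosSemidef)
    (hT : T.PosSemidef) (a : ι → ℝ) :
    multivariateGaussian 0 (S + T) {x | ∀ i, x i < a i} =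
      ∫⁻ y, multivariateGaussian 0 T {x | ∀ i, x i < a i - y i} ∂(multivariateGaussian 0 S) := by
  rw [← conv_multivariateGaussian hS hT, ← lintegral_indicator_one (measurableSet_orthant a),
    Measure.lintegral_conv (measurable_one.indicator (measurableSet_orthant a))]
  refine lintegral_congr fun y => ?_
  rw [← lintegral_indicator_one (measurableSet_orthant _)]
  refine lintegral_congr fun x => ?_
  simp only [Set.indicator, Set.mem_ofPred_eq, PiLp.add_apply, Pi.one_apply, lt_sub_iff_add_lt']
  congr

lemma orthant_add_mono {S T₁ T₂ : Matrix ι ι ℝ} (hS : S.PosSemidef) (h₁ : T₁.PosSemidef)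
    (h₂ : T₂.PosSemidef) (h : ∀ a, orthant T₁ a ≤ orthant T₂ a) (a : ι → ℝ) :
    orthant (S + T₁) a ≤ orthant (S + T₂) a := by
  rw [← ENNReal.ofReal_le_ofReal_iff (orthant_nonneg _ _), ofReal_orthant, ofReal_orthant,
    multivariateGaussian_add_orthant hS h₁, multivariateGaussian_add_orthant hS h₂]
  refine lintegral_mono fun y => ?_
  simp only [← ofReal_orthant]
  exact ENNReal.ofReal_le_ofReal (h _)

/-- Adding independent noise that stays below `b` turns the threshold `a` into `a + b`. -/
lemma orthant_mul_orthant_le {S T : Matrix ι ι ℝ} (hS : S.PosSemidef) (hT : T.PosSemidef)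
    (a b : ι → ℝ) : orthant S a * orthant T b ≤ orthant (S + T) (a + b) := by
  rw [orthant, orthant, orthant, ← conv_multivariateGaussian hS hT, Measure.conv,
    ← measureReal_prod_prod, map_measureReal_apply (by fun_prop) (measurableSet_orthant _)]
  refine measureReal_mono fun p hp i => ?_
  exact add_lt_add (hp.1 i) (hp.2 i)

lemma map_smul_gaussianReal (v : ι → ℝ) (h : NNReal) :
    (gaussianReal 0 h).map (fun t => t • toLp 2 v) =
      multivariateGaussian 0 ((h : ℝ) • vecMulVec v v) := by
  have hps : ((h : ℝ) • vecMulVec v v).PosSemidef := by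
    have := posSemidef_vecMulVec_self_star v
    exact PosSemidef.smul (by simpa using this) h.2
  apply Measure.ext_of_charFun
  ext x
  have hm : Measurable (fun t : ℝ => t • toLp 2 v) := by fun_prop
  rw [charFun_multivariateGaussian hps, charFun_apply, integral_map hm.aemeasurable
    (by fun_prop)]
  simp_rw [real_inner_smul_left]
  have : ∀ t : ℝ, Complex.exp (((t * inner ℝ (toLp 2 v) x : ℝ) : ℂ) * Complex.I) =
      Complex.exp (((inner ℝ (toLp 2 v) x : ℝ) : ℂ) * t * Complex.I) := by
    intro t; push_cast; ring_nf
  simp_rw [this]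
  rw [← charFun_apply_real, charFun_gaussianReal]
  congr 1
  have h2 : inner ℝ (toLp 2 v) x = v ⬝ᵥ (x : ι → ℝ) := by
    simp [PiLp.inner_apply, dotProduct, mul_comm]
  rw [h2, Matrix.smul_mulVec, vecMulVec_mulVec]
  simp [dotProduct_comm]
  left
  ring

lemma posSemidef_smul_vecMulVec (v : ι → ℝ) {h : ℝ} (hh : 0 ≤ h) :
    (h • vecMulVec v v).PosSemidef := by
  have := posSemidef_vecMulVec_self_star v
  exact PosSemidef.smul (by simpa using this) hh

lemma orthant_smul_sq (S : Matrix ι ι ℝ) (hS : S.PosSemidef) {c : ℝ} (hc : 0 < c) (a : ι → ℝ) :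
    orthant (c ^ 2 • S) (c • a) = orthant S a := by
  have : multivariateGaussian 0 (c ^ 2 • S) =
      (multivariateGaussian 0 S).map (fun x => c • x) := by
    apply Measure.ext_of_charFun
    ext x
    rw [charFun_map_smul, charFun_multivariateGaussian hS,
      charFun_multivariateGaussian (hS.smul (by positivity))]
    congr 1
    simp [Matrix.smul_mulVec, Matrix.mulVec_smul]
    ring
  rw [orthant, this, map_measureReal_apply (by fun_prop) (measurableSet_orthant _), orthant]
  congr 1
  ext x
  simp [hc]

/-- The law of a centered Gaussian vector is determined by its covariance matrix. -/
lemma map_eq_multivariateGaussian {Ω : Type*} [MeasurableSpace Ω] {P : Measure Ω}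
    {X : ι → Ω → ℝ} (hX : HasGaussianLaw (fun ω i => X i ω) P) (h0 : ∀ i, ∫ ω, X i ω ∂P = 0)
    {S : Matrix ι ι ℝ} (hS : ∀ i j, covariance (X i) (X j) P = S i j) :
    S.PosSemidef ∧ P.map (fun ω => toLp 2 (fun i => X i ω)) = multivariateGaussian 0 S := by
  have hP := hX.isProbabilityMeasure
  have hm : ∀ i, MemLp (X i) 2 P := fun i => (hX.eval i).memLp_two
  have hvar : ∀ t : ι → ℝ, variance (fun ω => ∑ i, t i * X i ω) P = t ⬝ᵥ S *ᵥ t := by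
    intro t
    rw [← covariance_self ((memLp_finsetSum _ fun i _ =>
        (hm i).const_mul (t i)).aemeasurable), covariance_fun_sum_fun_sum
      (fun i => (hm i).const_mul (t i)) (fun i => (hm i).const_mul (t i))]
    simp_rw [covariance_const_mul_left, covariance_const_mul_right, hS, dotProduct, mulVec,
      dotProduct, Finset.mul_sum]
    exact Finset.sum_congr rfl fun i _ => Finset.sum_congr rfl fun j _ => by ring
  have hps : S.PosSemidef := by
    refine PosSemidef.of_dotProduct_mulVec_nonneg ?_ fun t => ?_
    · ext i j
      simp [← hS, covariance_comm]
    · rw [star_trivial, ← hvar]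
      exact variance_nonneg _ _
  refine ⟨hps, ?_⟩
  have hY := hX.toLp_pi 2
  have := hY.isGaussian_map.toIsProbabilityMeasure
  apply Measure.ext_of_charFun
  ext t
  have hin : ∀ ω, inner ℝ t (toLp 2 (fun i => X i ω)) = ∑ i, t i * X i ω := fun ω => by
    simp [PiLp.inner_apply, mul_comm]
  rw [hY.charFun_map_eq, charFun_multivariateGaussian hps]
  simp_rw [hin]
  rw [hvar, integral_finsetSum _ fun i _ => ((hm i).integrable one_le_two).const_mul _]
  simp [integral_const_mul, h0]

lemma measureReal_eq_orthant {Ω : Type*} [MeasurableSpace Ω] {P : Measure Ω}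
    {X : ι → Ω → ℝ} (hX : HasGaussianLaw (fun ω i => X i ω) P) (h0 : ∀ i, ∫ ω, X i ω ∂P = 0)
    {S : Matrix ι ι ℝ} (hS : ∀ i j, covariance (X i) (X j) P = S i j) (a : ι → ℝ) :
    P.real {ω | ∀ i, X i ω < a i} = orthant S a := by
  have := hX.isProbabilityMeasure
  rw [orthant, ← (map_eq_multivariateGaussian hX h0 hS).2, map_measureReal_apply_of_aemeasurable
    (hX.toLp_pi 2).aemeasurable (measurableSet_orthant a)]
  rfl

end Basics

section Slepian
variable {ι : Type*} [Fintype ι] [DecidableEq ι]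

/-- The symmetric matrix with entries one at `(i, j)` and `(j, i)`, for `i ≠ j`. -/
def pairMatrix (i j : ι) : Matrix ι ι ℝ :=
  vecMulVec (Pi.single i 1) (Pi.single j 1) + vecMulVec (Pi.single j 1) (Pi.single i 1)

lemma orthant_smul_vecMulVec (v a : ι → ℝ) (h : NNReal) :
    orthant ((h : ℝ) • vecMulVec v v) a = (gaussianReal 0 h).real {t | ∀ i, t * v i < a i} := by
  rw [orthant, ← map_smul_gaussianReal, map_measureReal_apply (by fun_prop)
    (measurableSet_orthant a)]
  simp

lemma orthant_diag_pair_le (i j : ι) (hij : i ≠ j) {h : ℝ} (hh : 0 ≤ h) (a : ι → ℝ) :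
    orthant (h • vecMulVec (Pi.single i 1) (Pi.single i 1) +
        h • vecMulVec (Pi.single j 1) (Pi.single j 1)) a ≤
      orthant (h • vecMulVec (Pi.single i 1 + Pi.single j 1) (Pi.single i 1 + Pi.single j 1)) a := by
  lift h to NNReal using hh
  rw [orthant_smul_vecMulVec, orthant, ← conv_multivariateGaussian
    (posSemidef_smul_vecMulVec _ h.coe_nonneg) (posSemidef_smul_vecMulVec _ h.coe_nonneg),
    ← map_smul_gaussianReal, ← map_smul_gaussianReal, Measure.conv,
    Measure.map_prod_map _ _ (by fun_prop) (by fun_prop),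
    map_measureReal_apply (by fun_prop) (measurableSet_orthant a),
    map_measureReal_apply (by fun_prop) (by
      exact (measurable_fst.add measurable_snd) (measurableSet_orthant a))]
  have hsum : ∀ p : ℝ × ℝ, p ∈ (Prod.map (fun t : ℝ => t • toLp 2 (Pi.single i (1 : ℝ)))
      (fun t : ℝ => t • toLp 2 (Pi.single j (1 : ℝ))) ⁻¹'
      ((fun x : EuclideanSpace ℝ ι × EuclideanSpace ℝ ι => x.1 + x.2) ⁻¹' {x | ∀ k, x k < a k})) →
      p.1 < a i ∧ p.2 < a j ∧ ∀ k, k ≠ i → k ≠ j → 0 < a k := by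
    intro p hp
    refine ⟨?_, ?_, fun k hi hj => ?_⟩
    · simpa [hij] using hp i
    · simpa [hij.symm] using hp j
    · simpa [hi, hj] using hp k
  by_cases hC : ∀ k, k ≠ i → k ≠ j → 0 < a k
  · calc _ ≤ ((gaussianReal 0 h).prod (gaussianReal 0 h)).real (Set.Iio (a i) ×ˢ Set.Iio (a j)) :=
          measureReal_mono fun p hp => ⟨(hsum p hp).1, (hsum p hp).2.1⟩
      _ = (gaussianReal 0 h).real (Set.Iio (a i)) * (gaussianReal 0 h).real (Set.Iio (a j)) :=
          measureReal_prod_prod _ _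
      _ ≤ (gaussianReal 0 h).real (Set.Iio (min (a i) (a j))) := by
          rcases le_total (a i) (a j) with hle | hle
          · rw [min_eq_left hle]
            exact mul_le_of_le_one_right measureReal_nonneg measureReal_le_one
          · rw [min_eq_right hle]
            exact mul_le_of_le_one_left measureReal_nonneg measureReal_le_one
      _ ≤ _ := by
          refine measureReal_mono fun t ht k => ?_
          have ht' := lt_min_iff.1 (Set.mem_Iio.1 ht)
          by_cases hi : k = i
          · subst hi; simpa [hij] using ht'.1
          · by_cases hj : k = j
            · subst hj; simpa [hij.symm] using ht'.2
            · simpa [hi, hj] using hC k hi hj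
  · refine (le_of_eq ?_).trans measureReal_nonneg
    convert measureReal_empty
    exact Set.eq_empty_of_forall_notMem fun p hp => hC (hsum p hp).2.2

lemma orthant_le_add_pairMatrix {S : Matrix ι ι ℝ} {i j : ι} (hij : i ≠ j) {h : ℝ} (hh : 0 ≤ h)
    (hS : (S - h • (vecMulVec (Pi.single i 1) (Pi.single i 1) +
      vecMulVec (Pi.single j 1) (Pi.single j 1))).PosSemidef) (a : ι → ℝ) :
    orthant S a ≤ orthant (S + h • pairMatrix i j) a := by
  have := orthant_add_mono hS ((posSemidef_smul_vecMulVec (Pi.single i (1 : ℝ)) hh).add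
    (posSemidef_smul_vecMulVec (Pi.single j (1 : ℝ)) hh)) (posSemidef_smul_vecMulVec _ hh)
    (orthant_diag_pair_le i j hij hh) a
  convert this using 2
  · rw [smul_add]; abel
  · rw [add_vecMulVec, vecMulVec_add, vecMulVec_add, pairMatrix]
    simp only [smul_add]
    abel

lemma posSemidef_one_sub_single (i : ι) :
    ((1 : Matrix ι ι ℝ) - vecMulVec (Pi.single i 1) (Pi.single i 1)).PosSemidef := by
  have : (1 : Matrix ι ι ℝ) - vecMulVec (Pi.single i 1) (Pi.single i 1) =
      diagonal (fun k => if k = i then 0 else 1) := by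
    ext k l
    by_cases hk : k = l
    · subst hk; by_cases hi : k = i
      · subst hi; simp [vecMulVec_apply]
      · simp [vecMulVec_apply, hi]
    · simp only [Matrix.sub_apply, one_apply_ne hk, vecMulVec_apply, diagonal_apply_ne _ hk, zero_sub]
      rw [Pi.single_apply, Pi.single_apply]
      split_ifs <;> simp_all
  rw [this]
  exact PosSemidef.diagonal fun k => by by_cases h : k = i <;> simp [h]

lemma posSemidef_two_add_pairMatrix (i j : ι) :
    ((2 : ℝ) • (1 : Matrix ι ι ℝ) + pairMatrix i j).PosSemidef := by
  have := ((posSemidef_one_sub_single i).add (posSemidef_one_sub_single j)).add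
    (posSemidef_smul_vecMulVec (Pi.single i (1 : ℝ) + Pi.single j 1) zero_le_one)
  convert this using 1
  rw [one_smul, add_vecMulVec, vecMulVec_add, vecMulVec_add, pairMatrix, two_smul]
  abel

lemma posSemidef_two_sub_single (i j : ι) :
    ((2 : ℝ) • (1 : Matrix ι ι ℝ) - (vecMulVec (Pi.single i 1) (Pi.single i 1) +
      vecMulVec (Pi.single j 1) (Pi.single j 1))).PosSemidef := by
  convert (posSemidef_one_sub_single i).add (posSemidef_one_sub_single j) using 1
  rw [two_smul]
  abel

lemma orthant_le_add_sum_pairMatrix (E : ι × ι → ℝ) (hE : ∀ p, 0 ≤ E p) (s : Finset (ι × ι))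
    (hs : ∀ p ∈ s, p.1 ≠ p.2) (a : ι → ℝ) (S : Matrix ι ι ℝ)
    (hS : (S - (2 * ∑ p ∈ s, E p) • (1 : Matrix ι ι ℝ)).PosSemidef) :
    orthant S a ≤ orthant (S + ∑ p ∈ s, E p • pairMatrix p.1 p.2) a := by
  induction s using Finset.induction_on generalizing S with
  | empty => simp
  | insert p s hp ih =>
    rw [Finset.sum_insert hp] at hS ⊢
    rw [← add_assoc]
    have hsum : 0 ≤ ∑ p ∈ s, E p := Finset.sum_nonneg fun p _ => hE p
    refine (orthant_le_add_pairMatrix (hs p (Finset.mem_insert_self _ _)) (hE p) ?_ a).trans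
      (ih (fun q hq => hs q (Finset.mem_insert_of_mem hq)) _ ?_)
    · convert (hS.add (PosSemidef.one.smul (show 0 ≤ 2 * ∑ p ∈ s, E p by positivity))).add
        ((posSemidef_two_sub_single p.1 p.2).smul (hE p)) using 1
      module
    · convert hS.add ((posSemidef_two_add_pairMatrix p.1 p.2).smul (hE p)) using 1
      module

lemma eq_sum_pairMatrix {E : Matrix ι ι ℝ} (hsymm : E.IsSymm) (hdiag : ∀ i, E i i = 0) :
    E = ∑ p ∈ (Finset.univ : Finset (ι × ι)).filter (fun p => p.1 ≠ p.2),
      (E p.1 p.2 / 2) • pairMatrix p.1 p.2 := by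
  rw [Finset.sum_filter_of_ne (by
    rintro ⟨i, j⟩ - h
    contrapose! h
    simp only at h
    subst h
    simp [hdiag])]
  ext k l
  simp only [Matrix.sum_apply, Matrix.smul_apply, pairMatrix, Matrix.add_apply, vecMulVec_apply,
    Fintype.sum_prod_type, smul_eq_mul, mul_add, Finset.sum_add_distrib, Pi.single_apply]
  simp [hsymm.apply k l]

lemma orthant_le_add_of_sum_le {S E : Matrix ι ι ℝ} (hsymm : E.IsSymm) (hdiag : ∀ i, E i i = 0)
    (hE : ∀ i j, 0 ≤ E i j) {c : ℝ} (hc : ∑ i, ∑ j, E i j ≤ c)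
    (hS : (S - c • (1 : Matrix ι ι ℝ)).PosSemidef) (a : ι → ℝ) :
    orthant S a ≤ orthant (S + E) a := by
  conv_rhs => rw [eq_sum_pairMatrix hsymm hdiag]
  refine orthant_le_add_sum_pairMatrix (fun p => E p.1 p.2 / 2)
    (fun p => div_nonneg (hE _ _) zero_le_two) _ (by simp) a S ?_
  have hle : 2 * ∑ p ∈ (Finset.univ : Finset (ι × ι)).filter (fun p => p.1 ≠ p.2),
      E p.1 p.2 / 2 ≤ c := by
    rw [← Finset.sum_div, mul_div_cancel₀ _ two_ne_zero]
    refine le_trans ?_ hc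
    rw [← Fintype.sum_prod_type' (f := fun i j => E i j)]
    exact Finset.sum_le_sum_of_subset_of_nonneg (Finset.filter_subset _ _) fun p _ _ => hE _ _
  convert hS.add (PosSemidef.one.smul (sub_nonneg.2 hle)) using 1
  module

/-- Slepian's inequality for uniformly nondegenerate covariance matrices. -/
lemma orthant_le_of_posSemidef_sub {S T : Matrix ι ι ℝ} {c : ℝ} (hc : 0 < c)
    (hS : (S - c • (1 : Matrix ι ι ℝ)).PosSemidef) (hT : (T - c • (1 : Matrix ι ι ℝ)).PosSemidef)
    (hdiag : ∀ i, S i i = T i i) (hle : ∀ i j, S i j ≤ T i j) (a : ι → ℝ) :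
    orthant S a ≤ orthant T a := by
  obtain ⟨N, hN⟩ := exists_nat_gt ((∑ i, ∑ j, (T - S) i j) / c)
  have hN' : 0 < (N : ℝ) := lt_of_le_of_lt (div_nonneg (Finset.sum_nonneg fun i _ =>
    Finset.sum_nonneg fun j _ => sub_nonneg.2 (hle i j)) hc.le) hN
  have hsymm : (T - S).IsSymm := by
    have h1 := hT.isHermitian.sub hS.isHermitian
    rw [sub_sub_sub_cancel_right] at h1
    simpa [IsHermitian, IsSymm] using h1
  have key : ∀ k : ℕ, k ≤ N → orthant S a ≤ orthant (S + ((k : ℝ) / N) • (T - S)) a := by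
    intro k
    induction k with
    | zero => simp
    | succ k ih =>
      intro hk
      refine (ih (by omega)).trans ?_
      have hkN : (k : ℝ) / N ≤ 1 := by
        rw [div_le_one hN']; exact_mod_cast (by omega : k ≤ N)
      have h := orthant_le_add_of_sum_le (S := S + ((k : ℝ) / N) • (T - S))
        (E := (1 / N : ℝ) • (T - S)) (hsymm.smul _) (by simp [hdiag])
        (fun i j => mul_nonneg (by positivity) (sub_nonneg.2 (hle i j))) (c := c) ?_ ?_ a
      · have hk1 : S + (((k + 1 : ℕ) : ℝ) / N) • (T - S) =
            S + ((k : ℝ) / N) • (T - S) + (1 / N : ℝ) • (T - S) := by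
          push_cast
          module
        rwa [hk1]
      · simp only [Matrix.smul_apply, smul_eq_mul, ← Finset.mul_sum]
        rw [div_lt_iff₀ hc] at hN
        rw [one_div, inv_mul_le_iff₀ hN']
        exact hN.le
      · convert (hS.smul (sub_nonneg.2 hkN)).add
          (hT.smul (show 0 ≤ (k : ℝ) / N by positivity)) using 1
        module
  have := key N le_rfl
  rwa [div_self hN'.ne', one_smul, add_sub_cancel] at this

end Slepian

section Continuity
variable {ι : Type*} [Fintype ι] [DecidableEq ι]

lemma multivariateGaussian_frontier_orthant {S : Matrix ι ι ℝ} (hS : S.PosSemidef)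
    (hpos : ∀ i, 0 < S i i) (a : ι → ℝ) :
    multivariateGaussian 0 S (frontier {x : EuclideanSpace ℝ ι | ∀ i, x i < a i}) = 0 := by
  have hcl : IsClosed {x : EuclideanSpace ℝ ι | ∀ i, x i ≤ a i} := by
    simp only [Set.ofPred_forall]
    exact isClosed_iInter fun i => isClosed_le (by fun_prop) continuous_const
  have hop : IsOpen {x : EuclideanSpace ℝ ι | ∀ i, x i < a i} := by
    simp only [Set.ofPred_forall]
    exact isOpen_iInter_of_finite fun i => isOpen_lt (by fun_prop) continuous_const
  have hsub : frontier {x : EuclideanSpace ℝ ι | ∀ i, x i < a i} ⊆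
      ⋃ i, {x : EuclideanSpace ℝ ι | x i = a i} := by
    rw [hop.frontier_eq]
    rintro x ⟨hx, hx'⟩
    have hle : x ∈ {x : EuclideanSpace ℝ ι | ∀ i, x i ≤ a i} :=
      closure_minimal (Set.ofPred_subset_ofPred.2 fun y hy i => (hy i).le) hcl hx
    simp only [Set.mem_ofPred_eq, not_forall, not_lt] at hx'
    obtain ⟨i, hi⟩ := hx'
    exact Set.mem_iUnion.2 ⟨i, le_antisymm (hle i) hi⟩
  refine measure_mono_null hsub (measure_iUnion_null fun i => ?_)
  have h := measurePreserving_eval_multivariateGaussian (μ := 0) hS (i := i)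
  have hne : (S i i).toNNReal ≠ 0 := by simpa using hpos i
  have : NullSingletonClass (gaussianReal ((0 : EuclideanSpace ℝ ι) i) (S i i).toNNReal) :=
    nullSingletonClass_gaussianReal hne
  have h2 := h.measure_preimage (s := {a i}) (measurableSet_singleton _).nullMeasurableSet
  rw [measure_singleton] at h2
  exact h2

lemma tendsto_orthant {S : Matrix ι ι ℝ} (hS : S.PosSemidef) (hpos : ∀ i, 0 < S i i)
    {T : ℕ → Matrix ι ι ℝ} (hT : ∀ n, (T n).PosSemidef) (hlim : Tendsto T atTop (𝓝 S))
    (a : ι → ℝ) : Tendsto (fun n => orthant (T n) a) atTop (𝓝 (orthant S a)) := by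
  let μ : ℕ → ProbabilityMeasure (EuclideanSpace ℝ ι) := fun n =>
    ⟨multivariateGaussian 0 (T n), inferInstance⟩
  let μ₀ : ProbabilityMeasure (EuclideanSpace ℝ ι) := ⟨multivariateGaussian 0 S, inferInstance⟩
  have hμ : Tendsto μ atTop (𝓝 μ₀) := by
    refine ProbabilityMeasure.tendsto_of_tendsto_charFun fun t => ?_
    simp only [μ, μ₀, ProbabilityMeasure.coe_mk, charFun_multivariateGaussian hS,
      fun n => charFun_multivariateGaussian (μ := 0) (hT n)]
    have hq : Tendsto (fun n => (t : ι → ℝ) ⬝ᵥ T n *ᵥ t) atTop (𝓝 ((t : ι → ℝ) ⬝ᵥ S *ᵥ t)) := by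
      have : Continuous fun M : Matrix ι ι ℝ => (t : ι → ℝ) ⬝ᵥ M *ᵥ t := by fun_prop
      exact (this.tendsto S).comp hlim
    have hq' := (Complex.continuous_ofReal.tendsto _).comp hq
    exact (Complex.continuous_exp.tendsto _).comp
      (tendsto_const_nhds.sub (hq'.div_const 2))
  have := ProbabilityMeasure.tendsto_measure_of_null_frontier_of_tendsto' hμ
    (multivariateGaussian_frontier_orthant hS hpos a)
  exact (ENNReal.continuousAt_toReal (measure_ne_top _ _)).tendsto.comp this

lemma exists_forall_abs_orthant_sub_lt {S : Matrix ι ι ℝ} (hS : S.PosSemidef)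
    (hpos : ∀ i, 0 < S i i) (a : ι → ℝ) {ε : ℝ} (hε : 0 < ε) :
    ∃ δ > 0, ∀ T : Matrix ι ι ℝ, T.PosSemidef → (∀ i j, |T i j - S i j| < δ) →
      |orthant T a - orthant S a| < ε := by
  by_contra! h
  choose T hT hTS hfar using fun n : ℕ => h (1 / (n + 1 : ℝ)) (by positivity)
  have hlim : Tendsto T atTop (𝓝 S) := by
    refine tendsto_pi_nhds.2 fun i => tendsto_pi_nhds.2 fun j => ?_
    rw [tendsto_iff_dist_tendsto_zero]
    refine squeeze_zero (fun n => dist_nonneg) (fun n => ?_) tendsto_one_div_add_atTop_nhds_zero_nat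
    exact (hTS n i j).le
  have := (tendsto_orthant hS hpos hT hlim a).sub_const (orthant S a)
  rw [sub_self] at this
  obtain ⟨n, hn⟩ := ((tendsto_zero_iff_abs_tendsto_zero _).1 this |>.eventually
    (gt_mem_nhds hε)).exists
  exact absurd hn (not_lt.2 (hfar n))

/-- **Slepian's inequality**. -/
theorem orthant_le_orthant {S T : Matrix ι ι ℝ} (hS : S.PosSemidef) (hT : T.PosSemidef)
    (hpos : ∀ i, 0 < S i i) (hdiag : ∀ i, S i i = T i i) (hle : ∀ i j, S i j ≤ T i j)
    (a : ι → ℝ) : orthant S a ≤ orthant T a := by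
  let c : ℕ → ℝ := fun n => 1 / ((n : ℝ) + 1)
  have hc : ∀ n, 0 < c n := fun n => by positivity
  have hlim : ∀ M : Matrix ι ι ℝ, Tendsto (fun n => M + c n • (1 : Matrix ι ι ℝ)) atTop (𝓝 M) := by
    intro M
    have : Tendsto c atTop (𝓝 0) := tendsto_one_div_add_atTop_nhds_zero_nat
    simpa using tendsto_const_nhds.add (this.smul_const (1 : Matrix ι ι ℝ))
  have hps : ∀ M : Matrix ι ι ℝ, M.PosSemidef → ∀ n,
      (M + c n • (1 : Matrix ι ι ℝ)).PosSemidef :=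
    fun M hM n => hM.add (PosSemidef.one.smul (hc n).le)
  refine le_of_tendsto_of_tendsto' (tendsto_orthant hS hpos (hps S hS) (hlim S) a)
    (tendsto_orthant hT (fun i => hdiag i ▸ hpos i) (hps T hT) (hlim T) a) fun n => ?_
  refine orthant_le_of_posSemidef_sub (hc n) (by simpa) (by simpa) (fun i => ?_)
    (fun i j => ?_) a
  · simp [hdiag]
  · simpa using hle i j

end Continuity

section Blocks
variable {κ ι : Type*} [Fintype κ] [DecidableEq κ] [Fintype ι] [DecidableEq ι]

lemma hasGaussianLaw_eval (S : Matrix ι ι ℝ) :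
    HasGaussianLaw (fun (x : EuclideanSpace ℝ ι) (i : ι) => x i) (multivariateGaussian 0 S) := by
  have := (IsGaussian.hasGaussianLaw_id (μ := multivariateGaussian 0 S)).map_equiv
    (PiLp.continuousLinearEquiv 2 ℝ (fun _ : ι => ℝ))
  exact this

lemma integral_eval_multivariateGaussian (S : Matrix ι ι ℝ) (i : ι) :
    ∫ x, x i ∂(multivariateGaussian 0 S) = 0 := by
  have := (EuclideanSpace.proj i : EuclideanSpace ℝ ι →L[ℝ] ℝ).integral_comp_id_comm
    (IsGaussian.integrable_id (μ := multivariateGaussian 0 S))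
  simpa using this

/-- A Gaussian vector made of uncorrelated blocks has independent blocks. -/
lemma orthant_eq_prod {S : Matrix (κ × ι) (κ × ι) ℝ} (hS : S.PosSemidef)
    (hblock : ∀ p q, p.1 ≠ q.1 → S p q = 0) (a : κ × ι → ℝ) :
    orthant S a = ∏ k, orthant (S.submatrix (Prod.mk k) (Prod.mk k)) (fun i => a (k, i)) := by
  let P := multivariateGaussian 0 S
  let X : κ → ι → EuclideanSpace ℝ (κ × ι) → ℝ := fun k i x => x (k, i)
  have hG : IsGaussianProcess (fun (p : (_ : κ) × ι) ω => X p.1 p.2 ω) P := by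
    refine ⟨fun I => ?_⟩
    exact (hasGaussianLaw_eval S).map (ContinuousLinearMap.pi fun p : I =>
      ContinuousLinearMap.proj (R := ℝ) (φ := fun _ : κ × ι => ℝ) (p.1.1, p.1.2))
  have hI : iIndepFun (fun k ω i => X k i ω) P :=
    hG.iIndepFun_of_covariance_eq_zero (fun k i => by fun_prop) fun k l hkl i j => by
      simp only [X, P]
      rw [covariance_eval_multivariateGaussian hS, hblock _ _ hkl]
  have hset : {x : EuclideanSpace ℝ (κ × ι) | ∀ p, x p < a p} =
      ⋂ k ∈ (Finset.univ : Finset κ), (fun ω i => X k i ω) ⁻¹' {y | ∀ i, y i < a (k, i)} := by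
    ext x
    simp [X]
  have hmeas : ∀ k, MeasurableSet {y : ι → ℝ | ∀ i, y i < a (k, i)} := fun k => by
    simp only [Set.ofPred_forall]
    exact MeasurableSet.iInter fun i => measurableSet_lt (by fun_prop) measurable_const
  have h1 := hI.measure_inter_preimage_eq_mul Finset.univ (fun k _ => hmeas k)
  rw [orthant, Measure.real, hset, h1, ENNReal.toReal_prod]
  refine Finset.prod_congr rfl fun k _ => ?_
  rw [← measureReal_eq_orthant (P := P) (X := X k) ?_ ?_ ?_]
  · rfl
  · exact (hasGaussianLaw_eval S).map (ContinuousLinearMap.pi fun i : ι =>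
      ContinuousLinearMap.proj (R := ℝ) (φ := fun _ : κ × ι => ℝ) (k, i))
  · exact fun i => integral_eval_multivariateGaussian S _
  · exact fun i j => covariance_eval_multivariateGaussian hS _ _

end Blocks

section Density
variable {ι : Type*} [Fintype ι] [DecidableEq ι]

lemma smul_gaussianReal_le {a l : NNReal} (ha : 0 < a) (hal : a ≤ l) :
    ENNReal.ofReal √(a / l) • gaussianReal 0 a ≤ gaussianReal 0 l := by
  have hl : 0 < l := ha.trans_le hal
  rw [gaussianReal_of_var_ne_zero _ ha.ne', gaussianReal_of_var_ne_zero _ hl.ne',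
    ← withDensity_smul _ (measurable_gaussianPDF _ _)]
  refine withDensity_mono (ae_of_all _ fun x => ?_)
  simp only [Pi.smul_apply, smul_eq_mul, gaussianPDF]
  rw [← ENNReal.ofReal_mul (Real.sqrt_nonneg _)]
  refine ENNReal.ofReal_le_ofReal ?_
  have ha' : (0 : ℝ) < a := ha
  have hl' : (0 : ℝ) < l := hl
  have hal' : (a : ℝ) ≤ l := hal
  rw [gaussianPDFReal, gaussianPDFReal, ← mul_assoc]
  have hcoef : √((a : ℝ) / l) * (√(2 * Real.pi * a))⁻¹ = (√(2 * Real.pi * l))⁻¹ := by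
    rw [← Real.sqrt_inv, ← Real.sqrt_inv, ← Real.sqrt_mul (by positivity)]
    congr 1
    field_simp
  rw [hcoef]
  refine mul_le_mul_of_nonneg_left (Real.exp_le_exp.2 ?_) (by positivity)
  rw [neg_div, neg_div, neg_le_neg_iff]
  gcongr

lemma smul_multivariateGaussian_sum_le {κ : Type*} [DecidableEq κ] (v : κ → ι → ℝ)
    {a b : NNReal} (ha : 0 < a) (l : κ → NNReal) (hal : ∀ k, a ≤ l k) (hlb : ∀ k, l k ≤ b)
    (s : Finset κ) :
    ENNReal.ofReal √(a / b) ^ s.card •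
        multivariateGaussian 0 (∑ k ∈ s, (a : ℝ) • vecMulVec (v k) (v k)) ≤
      multivariateGaussian 0 (∑ k ∈ s, (l k : ℝ) • vecMulVec (v k) (v k)) := by
  induction s using Finset.induction_on with
  | empty => simp
  | insert k s hk ih =>
    have hps : ∀ c : κ → NNReal, ∀ s : Finset κ,
        (∑ k ∈ s, (c k : ℝ) • vecMulVec (v k) (v k)).PosSemidef := fun c s =>
      posSemidef_sum _ fun k _ => posSemidef_smul_vecMulVec (v k) (c k).coe_nonneg
    rw [Finset.sum_insert hk, Finset.sum_insert hk, Finset.card_insert_of_notMem hk,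
      ← conv_multivariateGaussian (posSemidef_smul_vecMulVec (v k) a.coe_nonneg)
        (hps (fun _ => a) s),
      ← conv_multivariateGaussian (posSemidef_smul_vecMulVec (v k) (l k).coe_nonneg) (hps l s)]
    have hl : 0 < l k := ha.trans_le (hal k)
    have hle : ENNReal.ofReal √(a / b) ≤ ENNReal.ofReal √(a / l k) := by
      refine ENNReal.ofReal_le_ofReal (Real.sqrt_le_sqrt ?_)
      have : (0 : ℝ) < l k := hl
      have : (l k : ℝ) ≤ b := hlb k
      gcongr
    have h1 : ENNReal.ofReal √(a / b) •
        multivariateGaussian 0 ((a : ℝ) • vecMulVec (v k) (v k)) ≤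
        multivariateGaussian 0 ((l k : ℝ) • vecMulVec (v k) (v k)) := by
      rw [← map_smul_gaussianReal, ← map_smul_gaussianReal, ← Measure.map_smul]
      refine Measure.map_mono (le_trans ?_ (smul_gaussianReal_le ha (hal k))) (by fun_prop)
      intro A
      simp only [Measure.smul_apply, smul_eq_mul]
      gcongr
    have hconv := Measure.map_mono (Measure.prod_mono h1 ih)
      (measurable_add (M := EuclideanSpace ℝ ι))
    refine le_trans (le_of_eq ?_) hconv
    rw [Measure.prod_smul_left, Measure.prod_smul_right, smul_smul, Measure.map_smul, pow_succ',
      Measure.conv]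

lemma eq_sum_eigenvalues {C : Matrix ι ι ℝ} (hC : C.IsHermitian) :
    C = ∑ k, hC.eigenvalues k •
      vecMulVec (hC.eigenvectorBasis k : ι → ℝ) (hC.eigenvectorBasis k) := by
  conv_lhs => rw [hC.spectral_theorem]
  ext i j
  simp only [Unitary.conjStarAlgAut_apply, Matrix.sum_apply, Matrix.smul_apply, vecMulVec_apply,
    mul_apply, diagonal_apply, Function.comp_apply, RCLike.ofReal_real_eq_id, id_eq, mul_ite,
    mul_zero, Finset.sum_ite_eq', Finset.mem_univ, if_true, star_apply, star_trivial,
    IsHermitian.eigenvectorUnitary_apply, smul_eq_mul]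
  exact Finset.sum_congr rfl fun k _ => by ring

lemma sum_vecMulVec_eigenvectorBasis {C : Matrix ι ι ℝ} (hC : C.IsHermitian) :
    ∑ k, vecMulVec (hC.eigenvectorBasis k : ι → ℝ) (hC.eigenvectorBasis k) = 1 := by
  rw [← Unitary.coe_mul_star_self hC.eigenvectorUnitary]
  ext i j
  simp [Matrix.sum_apply, vecMulVec_apply, mul_apply, star_apply]

lemma orthant_one (b : ℝ) :
    orthant (1 : Matrix ι ι ℝ) (fun _ => b) =
      (gaussianReal 0 1).real (Set.Iio b) ^ Fintype.card ι := by
  rw [orthant, multivariateGaussian_zero_one, ← map_pi_eq_stdGaussian,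
    map_measureReal_apply (by fun_prop) (measurableSet_orthant _)]
  have : (toLp 2 : (ι → ℝ) → EuclideanSpace ℝ ι) ⁻¹' {x | ∀ i, x i < b} =
      Set.univ.pi fun _ => Set.Iio b := by
    ext x; simp
  rw [this, Measure.real, Measure.pi_pi, ENNReal.toReal_prod]
  simp [Measure.real]

lemma orthant_smul_one {a : ℝ} (ha : 0 < a) (b : ℝ) :
    orthant (a • (1 : Matrix ι ι ℝ)) (fun _ => b) =
      (gaussianReal 0 1).real (Set.Iio (b / √a)) ^ Fintype.card ι := by
  rw [← orthant_one, ← orthant_smul_sq _ PosSemidef.one (Real.sqrt_pos.2 ha), Real.sq_sqrt ha.le]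
  congr 1
  ext i
  have := (Real.sqrt_pos.2 ha).ne'
  simp
  field_simp

/-- A Gaussian vector whose covariance matrix lies between `a` and `b` times the identity is
dominated from below by a vector of independent variables of variance `a`. -/
lemma pow_mul_pow_le_orthant {C : Matrix ι ι ℝ} {a b : ℝ} (ha : 0 < a)
    (haC : (C - a • (1 : Matrix ι ι ℝ)).PosSemidef) (hCb : (b • (1 : Matrix ι ι ℝ) - C).PosSemidef)
    (η : ℝ) :
    (√(a / b) * (gaussianReal 0 1).real (Set.Iio (η / √a))) ^ Fintype.card ι ≤
      orthant C (fun _ => η) := by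
  rcases isEmpty_or_nonempty ι with hι | ⟨⟨i₀⟩⟩
  · simp [orthant]
  have hC : C.IsHermitian := by
    have := haC.add (PosSemidef.one.smul ha.le)
    rw [sub_add_cancel] at this
    exact this.isHermitian
  have hnorm : ∀ k, (hC.eigenvectorBasis k : ι → ℝ) ⬝ᵥ (hC.eigenvectorBasis k : ι → ℝ) = 1 := by
    intro k
    have := hC.eigenvectorBasis.inner_eq_one k
    rw [EuclideanSpace.inner_eq_star_dotProduct] at this
    simpa using this
  have hev : ∀ k, a ≤ hC.eigenvalues k ∧ hC.eigenvalues k ≤ b := by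
    intro k
    have h1 := haC.dotProduct_mulVec_nonneg (hC.eigenvectorBasis k)
    have h2 := hCb.dotProduct_mulVec_nonneg (hC.eigenvectorBasis k)
    simp only [sub_mulVec, hC.mulVec_eigenvectorBasis, smul_mulVec, one_mulVec, star_trivial,
      dotProduct_sub, dotProduct_smul, hnorm, smul_eq_mul, mul_one, sub_nonneg] at h1 h2
    exact ⟨h1, h2⟩
  have hb : 0 < b := ha.trans_le ((hev i₀).1.trans (hev i₀).2)
  have key := smul_multivariateGaussian_sum_le (fun k => (hC.eigenvectorBasis k : ι → ℝ))
    (a := a.toNNReal) (b := b.toNNReal) (by simpa) (fun k => (hC.eigenvalues k).toNNReal)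
    (fun k => Real.toNNReal_le_toNNReal (hev k).1) (fun k => Real.toNNReal_le_toNNReal (hev k).2)
    Finset.univ
  simp only [Real.coe_toNNReal _ ha.le, Real.coe_toNNReal _ hb.le,
    fun k => Real.coe_toNNReal _ (ha.le.trans (hev k).1), ← Finset.smul_sum,
    sum_vecMulVec_eigenvectorBasis hC, ← eq_sum_eigenvalues hC] at key
  have h2 := key {x | ∀ i, x i < η}
  rw [Measure.smul_apply, smul_eq_mul, ← ofReal_orthant _ (fun _ => η),
    ← ofReal_orthant _ (fun _ => η), ← ENNReal.ofReal_pow (Real.sqrt_nonneg _),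
    ← ENNReal.ofReal_mul (by positivity), ENNReal.ofReal_le_ofReal_iff (orthant_nonneg _ _),
    orthant_smul_one ha, Finset.card_univ, ← mul_pow] at h2
  exact h2

end Density

section Shift
variable {ι : Type*} [Fintype ι] [DecidableEq ι]

lemma gaussianPDF_one_eq (m x : ℝ) :
    gaussianPDF m 1 x = ENNReal.ofReal (Real.exp (m * x - m ^ 2 / 2)) * gaussianPDF 0 1 x := by
  rw [gaussianPDF, gaussianPDF, ← ENNReal.ofReal_mul (Real.exp_nonneg _), gaussianPDFReal,
    gaussianPDFReal, mul_left_comm, ← Real.exp_add]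
  congr 4
  simp
  ring

lemma lintegral_exp_gaussianReal (m : ℝ) :
    ∫⁻ x, ENNReal.ofReal (Real.exp (m * x - m ^ 2 / 2)) ∂(gaussianReal 0 1) = 1 := by
  rw [gaussianReal_of_var_ne_zero _ one_ne_zero, lintegral_withDensity_eq_lintegral_mul _
    (measurable_gaussianPDF _ _) (by fun_prop), ← lintegral_gaussianPDF_eq_one m one_ne_zero]
  refine lintegral_congr fun x => ?_
  rw [gaussianPDF_one_eq m, Pi.mul_apply, mul_comm]

/-- Hölder's inequality for the density of a translated Gaussian law. -/
lemma gaussianReal_le_rpow_mul {p q : ℝ} (hpq : p.HolderConjugate q) (m : ℝ) {B : Set ℝ}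
    (hB : MeasurableSet B) :
    gaussianReal m 1 B ≤ gaussianReal 0 1 B ^ (1 / p) *
      ENNReal.ofReal (Real.exp ((q - 1) * m ^ 2 / 2)) := by
  have h1 : gaussianReal m 1 B = ∫⁻ x, (B.indicator 1 x) *
      ENNReal.ofReal (Real.exp (m * x - m ^ 2 / 2)) ∂(gaussianReal 0 1) := by
    rw [gaussianReal_apply _ one_ne_zero, ← lintegral_indicator hB,
      gaussianReal_of_var_ne_zero _ one_ne_zero, lintegral_withDensity_eq_lintegral_mul _
      (measurable_gaussianPDF _ _) (by
        exact (measurable_one.indicator hB).mul (by fun_prop))]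
    refine lintegral_congr fun x => ?_
    by_cases hx : x ∈ B
    · simp [hx, gaussianPDF_one_eq m, mul_comm]
    · simp [hx]
  rw [h1]
  refine (ENNReal.lintegral_mul_le_Lp_mul_Lq _ hpq (measurable_one.indicator hB).aemeasurable
    (by fun_prop)).trans (le_of_eq ?_)
  congr 1
  · congr 1
    rw [← lintegral_indicator_one hB]
    refine lintegral_congr fun x => ?_
    by_cases hx : x ∈ B
    · simp [hx]
    · simp [hx, hpq.pos]
  · have h2 : ∀ x : ℝ, ENNReal.ofReal (Real.exp (m * x - m ^ 2 / 2)) ^ q =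
        ENNReal.ofReal (Real.exp ((q - 1) * m ^ 2 / 2 * q)) *
          ENNReal.ofReal (Real.exp ((q * m) * x - (q * m) ^ 2 / 2)) := by
      intro x
      rw [ENNReal.ofReal_rpow_of_pos (Real.exp_pos _), ← ENNReal.ofReal_mul (Real.exp_nonneg _),
        ← Real.exp_mul, ← Real.exp_add]
      congr 2
      ring
    simp_rw [h2]
    rw [lintegral_const_mul _ (by fun_prop), lintegral_exp_gaussianReal, mul_one,
      ENNReal.ofReal_rpow_of_pos (Real.exp_pos _), ← Real.exp_mul, mul_assoc, mul_one_div_cancel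
      hpq.symm.ne_zero, mul_one]

lemma orthant_add_smul_le {p q : ℝ} (hpq : p.HolderConjugate q) {R : Matrix ι ι ℝ}
    (hR : R.PosSemidef) (w a : ι → ℝ) (s : ℝ) :
    orthant (R + vecMulVec w w) (a + s • w) ≤
      orthant (R + vecMulVec w w) a ^ (1 / p) * Real.exp ((q - 1) * s ^ 2 / 2) := by
  have hw : (vecMulVec w w).PosSemidef := by simpa using posSemidef_smul_vecMulVec w zero_le_one
  let B : (ι → ℝ) → Set ℝ := fun b => {t | ∀ i, t * w i < b i}
  have hB : ∀ b, MeasurableSet (B b) := fun b => by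
    simp only [B, Set.ofPred_forall]
    exact MeasurableSet.iInter fun i => measurableSet_lt (by fun_prop) measurable_const
  have hmv : ∀ b : ι → ℝ, multivariateGaussian 0 (vecMulVec w w) {x | ∀ i, x i < b i} =
      gaussianReal 0 1 (B b) := by
    intro b
    have := map_smul_gaussianReal w 1
    rw [NNReal.coe_one, one_smul] at this
    rw [← this, Measure.map_apply (by fun_prop) (measurableSet_orthant b)]
    rfl
  have hmeas : Measurable fun y : EuclideanSpace ℝ ι =>
      gaussianReal 0 1 (B fun i => a i - y i) := by
    have : MeasurableSet {z : EuclideanSpace ℝ ι × ℝ | ∀ i, z.2 * w i < a i - z.1 i} := by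
      simp only [Set.ofPred_forall]
      exact MeasurableSet.iInter fun i => measurableSet_lt (by fun_prop) (by fun_prop)
    exact measurable_measure_prodMk_left this
  have hshift : ∀ y : EuclideanSpace ℝ ι,
      gaussianReal 0 1 (B fun i => (a + s • w) i - y i) =
        gaussianReal (-s) 1 (B fun i => a i - y i) := by
    intro y
    have := gaussianReal_map_add_const (μ := 0) (v := 1) (-s)
    rw [zero_add] at this
    rw [← this, Measure.map_apply (by fun_prop) (hB _)]
    congr 1
    ext t
    refine forall_congr' fun i => ?_
    simp only [Pi.add_apply, Pi.smul_apply, smul_eq_mul]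
    constructor <;> intro h <;> linarith
  rw [← ENNReal.ofReal_le_ofReal_iff (mul_nonneg (Real.rpow_nonneg (orthant_nonneg _ _) _)
    (Real.exp_nonneg _)), ENNReal.ofReal_mul (Real.rpow_nonneg (orthant_nonneg _ _) _),
    ← ENNReal.ofReal_rpow_of_nonneg (orthant_nonneg _ _) (by simpa using hpq.nonneg),
    ofReal_orthant, ofReal_orthant, multivariateGaussian_add_orthant hR hw,
    multivariateGaussian_add_orthant hR hw]
  simp only [hmv, hshift]
  calc _ ≤ ∫⁻ y, gaussianReal 0 1 (B fun i => a i - y i) ^ (1 / p) *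
        ENNReal.ofReal (Real.exp ((q - 1) * s ^ 2 / 2)) ∂(multivariateGaussian 0 R) := by
        refine lintegral_mono fun y => ?_
        simpa using gaussianReal_le_rpow_mul hpq (-s) (hB fun i => a i - y i)
    _ = (∫⁻ y, gaussianReal 0 1 (B fun i => a i - y i) ^ (1 / p) * 1
          ∂(multivariateGaussian 0 R)) * ENNReal.ofReal (Real.exp ((q - 1) * s ^ 2 / 2)) := by
        rw [lintegral_mul_const _ (hmeas.pow_const _)]
        simp
    _ ≤ _ := by
        gcongr
        refine (ENNReal.lintegral_mul_le_Lp_mul_Lq _ hpq (hmeas.pow_const _).aemeasurable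
          aemeasurable_const).trans (le_of_eq ?_)
        simp [← ENNReal.rpow_mul, inv_mul_cancel₀ hpq.ne_zero]

lemma posSemidef_sub_vecMulVec {S : Matrix ι ι ℝ} (hS : S.PosSemidef) (u : ι → ℝ)
    (hu : 0 < u ⬝ᵥ S *ᵥ u) :
    (S - (u ⬝ᵥ S *ᵥ u)⁻¹ • vecMulVec (S *ᵥ u) (S *ᵥ u)).PosSemidef := by
  have hsymm : Sᵀ = S := by simpa [IsHermitian] using hS.isHermitian
  refine PosSemidef.of_dotProduct_mulVec_nonneg ?_ fun x => ?_
  · ext i j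
    have := congrFun (congrFun hsymm i) j
    simp only [transpose_apply] at this
    simp [vecMulVec_apply, this, mul_comm]
  · set t := (x ⬝ᵥ S *ᵥ u) / (u ⬝ᵥ S *ᵥ u) with ht
    have h := hS.dotProduct_mulVec_nonneg (x - t • u)
    have hux : u ⬝ᵥ S *ᵥ x = x ⬝ᵥ S *ᵥ u := by
      rw [dotProduct_mulVec, ← mulVec_transpose, hsymm, dotProduct_comm]
    simp only [star_trivial, mulVec_sub, mulVec_smul, sub_dotProduct, dotProduct_sub,
      smul_dotProduct, dotProduct_smul, smul_eq_mul, hux] at h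
    simp only [star_trivial, sub_mulVec, smul_mulVec, vecMulVec_mulVec, dotProduct_sub,
      dotProduct_smul, smul_eq_mul]
    have e : (S *ᵥ u) ⬝ᵥ x = x ⬝ᵥ S *ᵥ u := dotProduct_comm _ _
    simp only [e, op_smul_eq_smul, smul_eq_mul]
    have : t * (u ⬝ᵥ S *ᵥ u) = x ⬝ᵥ S *ᵥ u := by rw [ht]; field_simp
    have h3 : (u ⬝ᵥ S *ᵥ u)⁻¹ * (x ⬝ᵥ S *ᵥ u * x ⬝ᵥ S *ᵥ u) = t * (x ⬝ᵥ S *ᵥ u) := by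
      rw [ht]; field_simp
    rw [h3]
    linear_combination h + t * this

/-- Raising the threshold of a nonnegatively correlated Gaussian vector by `η` costs at most an
exponential factor controlled by the sum of the correlations. -/
lemma orthant_add_const_le [Nonempty ι] {S : Matrix ι ι ℝ} (hS : S.PosSemidef)
    (hdiag : ∀ i, S i i = 1) (hnonneg : ∀ i j, 0 ≤ S i j) {p q : ℝ} (hpq : p.HolderConjugate q)
    (r : ℝ) {η : ℝ} (hη : 0 ≤ η) :
    orthant S (fun _ => r + η) ≤ orthant S (fun _ => r) ^ (1 / p) *
      Real.exp ((q - 1) * (η ^ 2 * ∑ i, ∑ j, S i j) / 2) := by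
  set m : ℝ := ∑ i, ∑ j, S i j with hm
  have hrow : ∀ i, 1 ≤ ∑ j, S i j := fun i =>
    (hdiag i).symm.le.trans (Finset.single_le_sum (fun j _ => hnonneg i j) (Finset.mem_univ i))
  have hmpos : 0 < m := Finset.sum_pos (fun i _ => one_pos.trans_le (hrow i)) Finset.univ_nonempty
  have hS1 : S *ᵥ (1 : ι → ℝ) = fun i => ∑ j, S i j := by
    ext i; simp [mulVec, dotProduct]
  have hm1 : (1 : ι → ℝ) ⬝ᵥ S *ᵥ 1 = m := by rw [hS1]; simp [dotProduct, hm]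
  have hR := posSemidef_sub_vecMulVec hS 1 (by rw [hm1]; exact hmpos)
  rw [hm1] at hR
  have hsq : (√m)⁻¹ * (√m)⁻¹ = m⁻¹ := by rw [← mul_inv, Real.mul_self_sqrt hmpos.le]
  have h := orthant_add_smul_le hpq hR ((√m)⁻¹ • (S *ᵥ 1)) (fun _ => r) (η * √m)
  rw [smul_vecMulVec, vecMulVec_smul, smul_smul, hsq, sub_add_cancel, mul_pow,
    Real.sq_sqrt hmpos.le] at h
  refine (orthant_mono S fun i => ?_).trans h
  have hs : √m ≠ 0 := (Real.sqrt_pos.2 hmpos).ne'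
  simp only [hS1, Pi.add_apply, Pi.smul_apply, smul_eq_mul]
  rw [mul_assoc, mul_inv_cancel_left₀ hs]
  have := mul_le_mul_of_nonneg_left (hrow i) hη
  linarith

end Shift

section BlockPart
variable {κ ι : Type*} [Fintype κ] [DecidableEq κ] [Fintype ι] [DecidableEq ι]

/-- The block diagonal part of a matrix. -/
def blockPart (S : Matrix (κ × ι) (κ × ι) ℝ) : Matrix (κ × ι) (κ × ι) ℝ :=
  Matrix.of fun p q => if p.1 = q.1 then S p q else 0

lemma blockPart_apply (S : Matrix (κ × ι) (κ × ι) ℝ) (p q : κ × ι) :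
    blockPart S p q = if p.1 = q.1 then S p q else 0 := rfl

lemma posSemidef_blockPart {S : Matrix (κ × ι) (κ × ι) ℝ} (hS : S.PosSemidef) :
    (blockPart S).PosSemidef := by
  let D : κ → Matrix (κ × ι) (κ × ι) ℝ := fun k => diagonal fun p => if p.1 = k then 1 else 0
  have : blockPart S = ∑ k, (D k)ᴴ * S * D k := by
    ext p q
    simp [D, Matrix.sum_apply, blockPart_apply, diagonal_mul, mul_diagonal,
      ← ite_and]
    by_cases h : p.1 = q.1
    · simp [h]
    · rw [if_neg h, Finset.sum_eq_zero]
      rintro k -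
      rw [if_neg]
      rintro ⟨h1, h2⟩
      exact h (h2.trans h1.symm)
  rw [this]
  exact posSemidef_sum _ fun k _ => hS.conjTranspose_mul_mul_same _

lemma orthant_blockPart {S : Matrix (κ × ι) (κ × ι) ℝ} (hS : S.PosSemidef) (r : ℝ) :
    orthant (blockPart S) (fun _ => r) =
      ∏ k, orthant (S.submatrix (Prod.mk k) (Prod.mk k)) (fun _ => r) := by
  rw [orthant_eq_prod (posSemidef_blockPart hS) fun p q h => by simp [blockPart_apply, h]]
  refine Finset.prod_congr rfl fun k _ => ?_
  congr 1
  ext i j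
  simp [blockPart_apply]

lemma prod_orthant_le {S : Matrix (κ × ι) (κ × ι) ℝ} (hS : S.PosSemidef)
    (hdiag : ∀ p, S p p = 1) (hnonneg : ∀ p q, 0 ≤ S p q) (r : ℝ) :
    ∏ k, orthant (S.submatrix (Prod.mk k) (Prod.mk k)) (fun _ => r) ≤
      orthant S (fun _ => r) := by
  rw [← orthant_blockPart hS]
  refine orthant_le_orthant (posSemidef_blockPart hS) hS (fun p => by simp [blockPart_apply, hdiag])
    (fun p => by simp [blockPart_apply]) (fun p q => ?_) _
  rw [blockPart_apply]
  split_ifs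
  exacts [le_rfl, hnonneg p q]

lemma abs_dotProduct_mulVec_le {E : Matrix ι ι ℝ} (hsymm : E.IsSymm)
    (hE : ∀ i j, 0 ≤ E i j) {δ : ℝ} (hrow : ∀ i, ∑ j, E i j ≤ δ) (x : ι → ℝ) :
    |x ⬝ᵥ E *ᵥ x| ≤ δ * (x ⬝ᵥ x) := by
  have hcol : ∀ j, ∑ i, E i j ≤ δ := fun j => by
    simpa only [hsymm.apply] using hrow j
  have h1 : ∑ i, ∑ j, E i j * (x i ^ 2 / 2) ≤ ∑ i, δ * (x i ^ 2 / 2) :=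
    Finset.sum_le_sum fun i _ => by
      rw [← Finset.sum_mul]
      exact mul_le_mul_of_nonneg_right (hrow i) (by positivity)
  have h2 : ∑ i, ∑ j, E i j * (x j ^ 2 / 2) ≤ ∑ j, δ * (x j ^ 2 / 2) := by
    rw [Finset.sum_comm]
    refine Finset.sum_le_sum fun j _ => ?_
    rw [← Finset.sum_mul]
    exact mul_le_mul_of_nonneg_right (hcol j) (by positivity)
  calc |x ⬝ᵥ E *ᵥ x| = |∑ i, ∑ j, x i * (E i j * x j)| := by
        simp [dotProduct, mulVec, Finset.mul_sum]
    _ ≤ ∑ i, ∑ j, |x i * (E i j * x j)| :=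
        (Finset.abs_sum_le_sum_abs _ _).trans
          (Finset.sum_le_sum fun i _ => Finset.abs_sum_le_sum_abs _ _)
    _ ≤ ∑ i, ∑ j, (E i j * (x i ^ 2 / 2) + E i j * (x j ^ 2 / 2)) := by
        refine Finset.sum_le_sum fun i _ => Finset.sum_le_sum fun j _ => ?_
        rw [mul_left_comm, abs_mul, abs_of_nonneg (hE i j), ← mul_add]
        refine mul_le_mul_of_nonneg_left ?_ (hE i j)
        rw [abs_le]
        constructor <;> nlinarith [sq_nonneg (x i + x j), sq_nonneg (x i - x j)]
    _ ≤ ∑ i, δ * (x i ^ 2 / 2) + ∑ j, δ * (x j ^ 2 / 2) := by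
        simp only [Finset.sum_add_distrib]
        exact add_le_add h1 h2
    _ = δ * (x ⬝ᵥ x) := by
        rw [← Finset.sum_add_distrib, dotProduct, Finset.mul_sum]
        exact Finset.sum_congr rfl fun i _ => by ring

lemma posSemidef_smul_one_add {E : Matrix ι ι ℝ} (hsymm : E.IsSymm) {δ : ℝ}
    (h : ∀ x : ι → ℝ, -(δ * (x ⬝ᵥ x)) ≤ x ⬝ᵥ E *ᵥ x) :
    (δ • (1 : Matrix ι ι ℝ) + E).PosSemidef := by
  refine PosSemidef.of_dotProduct_mulVec_nonneg ?_ fun x => ?_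
  · have : E.IsHermitian := by simpa [IsHermitian, IsSymm] using hsymm
    exact ((PosSemidef.one (n := ι) (R := ℝ)).isHermitian.smul (IsSelfAdjoint.all δ)).add this
  · have := h x
    simp only [star_trivial, add_mulVec, smul_mulVec, one_mulVec, dotProduct_add, dotProduct_smul,
      smul_eq_mul]
    linarith

lemma orthant_mul_pow_le_prod {S : Matrix (κ × ι) (κ × ι) ℝ} (hS : S.PosSemidef)
    (hdiag : ∀ p, S p p = 1) (hnonneg : ∀ p q, 0 ≤ S p q) {δ v : ℝ} (hδ : δ < v)
    (hδ0 : 0 < δ) (hrow : ∀ p, ∑ q with p.1 ≠ q.1, S p q ≤ δ) {r r' η : ℝ}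
    (hr : (r + η) / √(1 + v) ≤ r') :
    orthant S (fun _ => r) *
        (√((v - δ) / (v + δ)) * (gaussianReal 0 1).real (Set.Iio (η / √(v - δ)))) ^
          Fintype.card (κ × ι) ≤
      ∏ k, orthant (S.submatrix (Prod.mk k) (Prod.mk k)) (fun _ => r') := by
  have hv : 0 < v := hδ0.trans hδ
  set D := blockPart S with hD
  have hDps : D.PosSemidef := posSemidef_blockPart hS
  set E := S - D with hEdef
  have hEapply : ∀ p q, E p q = if p.1 ≠ q.1 then S p q else 0 := by
    intro p q
    rw [hEdef, Matrix.sub_apply, hD, blockPart_apply]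
    by_cases h : p.1 = q.1 <;> simp [h]
  have hEsymm : E.IsSymm := by
    have : E.IsHermitian := hS.isHermitian.sub hDps.isHermitian
    simpa only [IsHermitian, IsSymm, conjTranspose_eq_transpose_of_trivial] using this
  have hE0 : ∀ p q, 0 ≤ E p q := fun p q => by
    rw [hEapply]; split_ifs
    exacts [hnonneg p q, le_rfl]
  have hErow : ∀ p, ∑ q, E p q ≤ δ := fun p => by
    simp only [hEapply]
    rw [← Finset.sum_filter]
    exact hrow p
  have habs := abs_dotProduct_mulVec_le hEsymm hE0 hErow
  have hplus := posSemidef_smul_one_add hEsymm fun x => (abs_le.1 (habs x)).1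
  have hminus := posSemidef_smul_one_add (E := -E) hEsymm.neg (δ := δ) fun x => by
    rw [neg_mulVec, dotProduct_neg, neg_le_neg_iff]
    exact (abs_le.1 (habs x)).2
  have hC := pow_mul_pow_le_orthant (C := v • (1 : Matrix (κ × ι) (κ × ι) ℝ) - E)
    (a := v - δ) (b := v + δ) (sub_pos.2 hδ)
    (by convert hminus using 1; module) (by convert hplus using 1; module) η
  have hCps : (v • (1 : Matrix (κ × ι) (κ × ι) ℝ) - E).PosSemidef := by
    convert hminus.add (PosSemidef.one.smul (sub_nonneg.2 hδ.le)) using 1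
    module
  have hc : 0 < √(1 + v) := Real.sqrt_pos.2 (by linarith)
  have hc2 : √(1 + v) ^ 2 = 1 + v := Real.sq_sqrt (by linarith)
  have h1v : (1 + v) ≠ 0 := by linarith
  have hD'ps : ((1 + v)⁻¹ • (D + v • (1 : Matrix (κ × ι) (κ × ι) ℝ))).PosSemidef :=
    (hDps.add (PosSemidef.one.smul hv.le)).smul (by positivity)
  have hDdiag : ∀ p, D p p = 1 := fun p => by simp [hD, blockPart_apply, hdiag]
  calc _ ≤ orthant S (fun _ => r) * orthant (v • (1 : Matrix (κ × ι) (κ × ι) ℝ) - E)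
          (fun _ => η) := mul_le_mul_of_nonneg_left hC (orthant_nonneg _ _)
    _ ≤ orthant (S + (v • (1 : Matrix (κ × ι) (κ × ι) ℝ) - E)) (fun _ => r + η) :=
        orthant_mul_orthant_le hS hCps _ _
    _ = orthant (√(1 + v) ^ 2 • ((1 + v)⁻¹ • (D + v • (1 : Matrix (κ × ι) (κ × ι) ℝ))))
          (√(1 + v) • fun _ => (r + η) / √(1 + v)) := by
        rw [hc2, smul_smul, mul_inv_cancel₀ h1v, one_smul]
        congr 1
        · rw [hEdef]; abel
        · ext p
          simp only [Pi.smul_apply, smul_eq_mul]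
          field_simp
    _ = orthant ((1 + v)⁻¹ • (D + v • (1 : Matrix (κ × ι) (κ × ι) ℝ)))
          (fun _ => (r + η) / √(1 + v)) := orthant_smul_sq _ hD'ps hc _
    _ ≤ orthant D (fun _ => (r + η) / √(1 + v)) := by
        have hd : ∀ p, ((1 + v)⁻¹ • (D + v • (1 : Matrix (κ × ι) (κ × ι) ℝ))) p p = 1 := by
          intro p
          simp [hDdiag, inv_mul_cancel₀ h1v]
        refine orthant_le_orthant hD'ps hDps (fun p => by rw [hd]; exact one_pos)
          (fun p => by rw [hd, hDdiag]) (fun p q => ?_) _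
        by_cases hpq : p = q
        · subst hpq; rw [hd, hDdiag]
        · have e : ((1 + v)⁻¹ • (D + v • (1 : Matrix (κ × ι) (κ × ι) ℝ))) p q =
              (1 + v)⁻¹ * D p q := by
            simp [one_apply_ne hpq]
          rw [e]
          have h0 : 0 ≤ D p q := by
            rw [hD, blockPart_apply]; split_ifs
            exacts [hnonneg p q, le_rfl]
          exact mul_le_of_le_one_left h0 (inv_le_one_of_one_le₀ (by linarith))
    _ ≤ orthant D (fun _ => r') := orthant_mono _ fun _ => hr
    _ = _ := orthant_blockPart hS r'

end BlockPart

section Correlation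

/-- The correlation matrix of a process at the times `f i`. -/
def corrMatrix {ι : Type*} (A : ℕ+ → ℕ+ → ℝ) (f : ι → ℕ+) : Matrix ι ι ℝ :=
  Matrix.of fun i j => A (f i) (f j)

/-- The times `s + 1, …, s + M`. -/
def window (M s : ℕ) (i : Fin M) : ℕ+ := (s + i).succPNat

/-- The times of the `k`-th window of length `M`, for windows starting every `G` time steps. -/
def windows (M G q : ℕ) (p : Fin q × Fin M) : ℕ+ := window M (p.1 * G) p.2

lemma submatrix_corrMatrix_windows (A : ℕ+ → ℕ+ → ℝ) (M G q : ℕ) (k : Fin q) :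
    (corrMatrix A (windows M G q)).submatrix (Prod.mk k) (Prod.mk k) =
      corrMatrix A (window M (k * G)) := rfl

lemma windows_val (M G q : ℕ) (p : Fin q × Fin M) :
    (windows M G q p : ℕ) = p.1 * G + p.2 + 1 := by simp [windows, window]

lemma corrMatrix_apply {ι : Type*} (A : ℕ+ → ℕ+ → ℝ) (f : ι → ℕ+) (i j : ι) :
    corrMatrix A f i j = A (f i) (f j) := rfl

variable {Ω : Type*} [MeasurableSpace Ω] {P : Measure Ω} {Z : ℕ+ → Ω → ℝ} {A : ℕ+ → ℕ+ → ℝ}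

namespace IsCenteredGaussianWithCorr

variable (h : IsCenteredGaussianWithCorr P Z A)
include h

lemma isProbabilityMeasure : IsProbabilityMeasure P := h.gaussian.isProbabilityMeasure

lemma corr_self (t : ℕ+) : A t t = 1 := by
  rw [← h.corr, covariance_self (h.gaussian.aemeasurable t), h.unit_variance]

lemma corr_comm (s t : ℕ+) : A s t = A t s := by
  rw [← h.corr, ← h.corr, covariance_comm]

variable {ι : Type*} [Fintype ι] [DecidableEq ι]

lemma hasGaussianLaw_comp (f : ι → ℕ+) : HasGaussianLaw (fun ω i => Z (f i) ω) P :=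
  ((h.gaussian.comp_right f).hasGaussianLaw Finset.univ).map (ContinuousLinearMap.pi fun i : ι =>
    ContinuousLinearMap.proj (R := ℝ) (φ := fun _ : (Finset.univ : Finset ι) => ℝ)
      ⟨i, Finset.mem_univ i⟩)

lemma posSemidef (f : ι → ℕ+) : (corrMatrix A f).PosSemidef :=
  (map_eq_multivariateGaussian (h.hasGaussianLaw_comp f) (fun _ => h.centered _)
    (S := corrMatrix A f) fun _ _ => h.corr _ _).1

lemma measureReal_eq (f : ι → ℕ+) (r : ℝ) :
    P.real {ω | ∀ i, Z (f i) ω < r} = orthant (corrMatrix A f) (fun _ => r) :=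
  measureReal_eq_orthant (h.hasGaussianLaw_comp f) (fun _ => h.centered _)
    (fun _ _ => h.corr _ _) _

lemma persistenceProb_le {f : ι → ℕ+} {n : ℕ} (hf : ∀ i, (f i : ℕ) ≤ n) (r : ℝ) :
    persistenceProb P Z r n ≤ orthant (corrMatrix A f) (fun _ => r) := by
  have := h.isProbabilityMeasure
  rw [← h.measureReal_eq]
  exact measureReal_mono fun ω hω i => hω _ (hf i)

lemma le_persistenceProb {f : ι → ℕ+} {n : ℕ} (hf : ∀ t : ℕ+, (t : ℕ) ≤ n → ∃ i, f i = t)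
    (r : ℝ) : orthant (corrMatrix A f) (fun _ => r) ≤ persistenceProb P Z r n := by
  have := h.isProbabilityMeasure
  rw [← h.measureReal_eq]
  refine measureReal_mono fun ω hω t ht => ?_
  obtain ⟨i, rfl⟩ := hf t ht
  exact hω i

lemma persistenceProb_eq (r : ℝ) (n : ℕ) :
    persistenceProb P Z r n = orthant (corrMatrix A (window n 0)) (fun _ => r) := by
  refine le_antisymm (h.persistenceProb_le (fun i => ?_) r)
    (h.le_persistenceProb (fun t ht => ?_) r)
  · simp [window]
  · have ht0 := t.pos
    refine ⟨⟨(t : ℕ) - 1, by omega⟩, PNat.eq ?_⟩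
    simp only [window, Nat.succPNat_coe]
    omega

/-- Slepian's inequality over consecutive windows. -/
lemma pow_le_persistenceProb {M : ℕ} (hM : 0 < M) {c r : ℝ} (hc : 0 ≤ c)
    (hblock : ∀ s, c ≤ orthant (corrMatrix A (window M s)) (fun _ => r)) (n : ℕ) :
    c ^ (n / M + 1) ≤ persistenceProb P Z r n := by
  have hf : ∀ t : ℕ+, (t : ℕ) ≤ n → ∃ p, windows M M (n / M + 1) p = t := by
    intro t ht
    have htpos := t.pos
    have hdiv : ((t : ℕ) - 1) / M < n / M + 1 :=
      Nat.lt_succ_of_le (Nat.div_le_div_right (by omega))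
    refine ⟨(⟨((t : ℕ) - 1) / M, hdiv⟩, ⟨((t : ℕ) - 1) % M, Nat.mod_lt _ hM⟩), ?_⟩
    apply PNat.eq
    rw [windows_val, Nat.div_add_mod' ((t : ℕ) - 1) M]
    omega
  calc c ^ (n / M + 1) = ∏ _k : Fin (n / M + 1), c := by simp
    _ ≤ ∏ k, orthant ((corrMatrix A (windows M M (n / M + 1))).submatrix
          (Prod.mk k) (Prod.mk k)) (fun _ => r) :=
        Finset.prod_le_prod (fun _ _ => hc) fun k _ => by
          rw [submatrix_corrMatrix_windows]
          exact hblock _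
    _ ≤ orthant (corrMatrix A (windows M M (n / M + 1))) (fun _ => r) :=
        prod_orthant_le (h.posSemidef _) (fun p => h.corr_self _) (fun p q => h.nonneg _ _) r
    _ ≤ _ := h.le_persistenceProb hf r

/-- Windows of length `M` separated by gaps of length `L` are almost independent, when the
correlations at distance at least `L` are small. -/
lemma persistenceProb_mul_pow_le {M L : ℕ} {δ v : ℝ} (hδ : δ < v) (hδ0 : 0 < δ)
    (hrow : ∀ (s : ℕ+) (F : Finset ℕ+), (∀ t ∈ F, L ≤ Nat.dist (s : ℕ) t) → ∑ t ∈ F, A s t ≤ δ)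
    {r r' η c : ℝ} (hr : (r + η) / √(1 + v) ≤ r')
    (hblock : ∀ s, orthant (corrMatrix A (window M s)) (fun _ => r') ≤ c) {n q : ℕ}
    (hq : q * (M + L) ≤ n) :
    persistenceProb P Z r n *
        (√((v - δ) / (v + δ)) * (gaussianReal 0 1).real (Set.Iio (η / √(v - δ)))) ^ (q * M) ≤
      c ^ q := by
  obtain ⟨f, hf⟩ : ∃ f, f = windows M (M + L) q := ⟨_, rfl⟩
  have hfval : ∀ p, (f p : ℕ) = p.1 * (M + L) + p.2 + 1 := fun p => by rw [hf, windows_val]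
  have hlt : ∀ p p' : Fin q × Fin M, p.1 < p'.1 → (f p : ℕ) + L < f p' := by
    intro p p' hp
    rw [hfval, hfval]
    have h1 : ((p.1 : ℕ) + 1) * (M + L) ≤ p'.1 * (M + L) := Nat.mul_le_mul_right _ hp
    have h2 := p.2.2
    rw [add_mul] at h1
    omega
  have hle : ∀ p, (f p : ℕ) ≤ n := by
    intro p
    rw [hfval]
    have h1 : ((p.1 : ℕ) + 1) * (M + L) ≤ q * (M + L) := Nat.mul_le_mul_right _ p.1.2
    have h2 := p.2.2
    rw [add_mul] at h1
    omega
  have hinj : Function.Injective f := by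
    rintro ⟨k, i⟩ ⟨k', i'⟩ hff
    have hff' : (f (k, i) : ℕ) = f (k', i') := by rw [hff]
    rcases lt_trichotomy k k' with hk | hk | hk
    · have := hlt (k, i) (k', i') hk; omega
    · subst hk
      rw [hfval, hfval] at hff'
      simp only at hff'
      exact Prod.ext rfl (Fin.ext (by simp only; omega))
    · have := hlt (k', i') (k, i) hk; omega
  have hrow' : ∀ p, ∑ p' with p.1 ≠ p'.1, corrMatrix A f p p' ≤ δ := by
    intro p
    have := hrow (f p) (({p' | p.1 ≠ p'.1} : Finset (Fin q × Fin M)).map ⟨f, hinj⟩) (by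
      intro t ht
      obtain ⟨p', hp', rfl⟩ := Finset.mem_map.1 ht
      have hne : p.1 ≠ p'.1 := (Finset.mem_filter.1 hp').2
      simp only [Function.Embedding.coeFn_mk, Nat.dist]
      rcases lt_or_gt_of_ne hne with hk | hk
      · have := hlt _ _ hk; omega
      · have := hlt _ _ hk; omega)
    rw [Finset.sum_map] at this
    exact this
  have key := orthant_mul_pow_le_prod (h.posSemidef f) (fun p => h.corr_self _)
    (fun p p' => h.nonneg _ _) hδ hδ0 hrow' hr
  have hcard : Fintype.card (Fin q × Fin M) = q * M := by simp
  rw [hcard] at key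
  refine (mul_le_mul_of_nonneg_right (h.persistenceProb_le hle r) (by positivity)).trans
    (key.trans ?_)
  calc ∏ k, orthant ((corrMatrix A f).submatrix (Prod.mk k) (Prod.mk k)) (fun _ => r')
      ≤ ∏ _k : Fin q, c := Finset.prod_le_prod (fun _ _ => orthant_nonneg _ _) fun k _ => by
        rw [hf, submatrix_corrMatrix_windows]
        exact hblock _
    _ = c ^ q := by simp

lemma persistenceProb_pos (r : ℝ) (n : ℕ) : 0 < persistenceProb P Z r n := by
  have hΦ : 0 < (gaussianReal 0 1).real (Set.Iio r) := by
    refine ENNReal.toReal_pos (fun h0 => ?_) (measure_ne_top _ _)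
    have := gaussianReal_absolutelyContinuous' 0 one_ne_zero h0
    simp at this
  have hb : ∀ s, corrMatrix A (window 1 s) = 1 := fun s => by
    ext i j
    rw [Subsingleton.elim i j, one_apply_eq, corrMatrix_apply, h.corr_self]
  have := h.pow_le_persistenceProb (M := 1) one_pos hΦ.le (r := r) (fun s => by
    rw [hb, orthant_one]; simp) n
  exact (pow_pos hΦ _).trans_le this

lemma persistenceProb_le_one (r : ℝ) (n : ℕ) : persistenceProb P Z r n ≤ 1 :=
  have := h.isProbabilityMeasure
  measureReal_le_one

end IsCenteredGaussianWithCorr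

lemma sum_dist_le (g : ℕ → ℝ≥0∞) (s : ℕ) (F : Finset ℕ) :
    ∑ t ∈ F, g (Nat.dist s t) ≤ 2 * ∑' i, g i := by
  have key : ∀ F : Finset ℕ, Set.InjOn (Nat.dist s) F → ∑ t ∈ F, g (Nat.dist s t) ≤ ∑' i, g i := by
    intro F hF
    rw [← Finset.sum_image (g := Nat.dist s) hF]
    exact ENNReal.sum_le_tsum _
  rw [← Finset.sum_filter_add_sum_filter_not F (fun t => s ≤ t), two_mul]
  refine add_le_add (key _ fun a ha b hb hab => ?_) (key _ fun a ha b hb hab => ?_)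
  all_goals
    simp only [Finset.coe_filter, Set.mem_ofPred_eq, Nat.dist] at ha hb hab
    omega

lemma corr_le_supCorr (hcomm : ∀ s t, A s t = A t s) (s t : ℕ+) :
    ENNReal.ofReal (A s t) ≤ supCorr A (Nat.dist (s : ℕ) t) := by
  have key : ∀ s t : ℕ+, (s : ℕ) ≤ t →
      ENNReal.ofReal (A s t) ≤ supCorr A (Nat.dist (s : ℕ) t) := by
    intro s t hst
    have : shift s (Nat.dist (s : ℕ) t) = t := by
      apply PNat.eq
      simp only [shift, PNat.mk_coe, Nat.dist]
      omega
    refine le_trans (le_of_eq ?_) (le_iSup _ s)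
    rw [this]
  rcases le_total (s : ℕ) t with hst | hst
  · exact key s t hst
  · rw [hcomm, Nat.dist_comm]
    exact key t s hst

lemma tsum_ite_le_eq (g : ℕ → ℝ≥0∞) (L : ℕ) :
    ∑' i, (if L ≤ i then g i else 0) = ∑' i, g (L + i) := by
  rw [← (add_right_injective L).tsum_eq]
  · simp
  · intro i hi
    have : L ≤ i := by
      by_contra hlt
      simp [hlt] at hi
    exact ⟨i - L, by simp; omega⟩

lemma sum_corr_le_of_tsum_le (hcomm : ∀ s t, A s t = A t s) (hnonneg : ∀ s t, 0 ≤ A s t) {L : ℕ}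
    {δ : ℝ} (hδ : 0 ≤ δ) (hL : ∑' i, supCorr A (L + i) ≤ ENNReal.ofReal (δ / 2)) (s : ℕ+)
    (F : Finset ℕ+) (hF : ∀ t ∈ F, L ≤ Nat.dist (s : ℕ) t) : ∑ t ∈ F, A s t ≤ δ := by
  rw [← ENNReal.ofReal_le_ofReal_iff hδ, ENNReal.ofReal_sum_of_nonneg fun t _ => hnonneg s t]
  calc ∑ t ∈ F, ENNReal.ofReal (A s t)
      ≤ ∑ t ∈ F, (fun i => if L ≤ i then supCorr A i else 0) (Nat.dist (s : ℕ) t) := by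
        refine Finset.sum_le_sum fun t ht => ?_
        simp only [hF t ht, if_true]
        exact corr_le_supCorr hcomm s t
    _ = ∑ t ∈ F.map ⟨_, PNat.coe_injective⟩,
          (fun i => if L ≤ i then supCorr A i else 0) (Nat.dist (s : ℕ) t) := by
        rw [Finset.sum_map]; rfl
    _ ≤ 2 * ∑' i, (if L ≤ i then supCorr A i else 0) := sum_dist_le _ _ _
    _ ≤ 2 * ENNReal.ofReal (δ / 2) := by
        rw [tsum_ite_le_eq]
        gcongr
    _ = ENNReal.ofReal δ := by
        rw [← ENNReal.ofReal_ofNat, ← ENNReal.ofReal_mul zero_le_two]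
        congr 1
        ring

end Correlation

section Stationary

lemma corrMatrix_window_stationary (Ainf : ℕ → ℝ) (M s : ℕ) (i j : Fin M) :
    corrMatrix (fun s t : ℕ+ => Ainf (Nat.dist (s : ℕ) t)) (window M s) i j =
      Ainf (Nat.dist i j) := by
  rw [corrMatrix_apply]
  congr 1
  simp only [window, Nat.succPNat_coe, Nat.dist]
  omega

variable {Ωinf : Type*} [MeasurableSpace Ωinf] {Pinf : Measure Ωinf}
  {Zinf : ℕ+ → Ωinf → ℝ} {Ainf : ℕ → ℝ}

lemma IsStationaryCenteredGaussianWithCorr.nonneg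
    (hZinf : IsStationaryCenteredGaussianWithCorr Pinf Zinf Ainf) (τ : ℕ) : 0 ≤ Ainf τ := by
  have := IsCenteredGaussianWithCorr.nonneg hZinf 1 (shift 1 τ)
  have hd : Nat.dist ((1 : ℕ+) : ℕ) (shift 1 τ : ℕ+) = τ := by
    simp only [shift, PNat.mk_coe, PNat.one_coe, Nat.dist]
    omega
  simpa only [hd] using this

lemma sum_corrMatrix_window_le (hnonneg : ∀ τ, 0 ≤ Ainf τ)
    (hsum : ∑' τ, ENNReal.ofReal (Ainf τ) ≠ ∞) (M : ℕ) :
    ∑ i, ∑ j, corrMatrix (fun s t : ℕ+ => Ainf (Nat.dist (s : ℕ) t)) (window M 0) i j ≤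
      (2 * ∑' τ, ENNReal.ofReal (Ainf τ)).toReal * M := by
  have hrow : ∀ i : Fin M, ∑ j : Fin M, Ainf (Nat.dist i j) ≤
      (2 * ∑' τ, ENNReal.ofReal (Ainf τ)).toReal := by
    intro i
    rw [← ENNReal.ofReal_le_iff_le_toReal (ENNReal.mul_ne_top (by simp) hsum),
      ENNReal.ofReal_sum_of_nonneg fun j _ => hnonneg _,
      Fin.sum_univ_eq_sum_range (fun j => ENNReal.ofReal (Ainf (Nat.dist i j)))]
    exact sum_dist_le (fun τ => ENNReal.ofReal (Ainf τ)) _ _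
  simp only [corrMatrix_window_stationary]
  refine (Finset.sum_le_sum fun i _ => hrow i).trans (le_of_eq ?_)
  simp [mul_comm]

variable {Ω : ℕ+ → Type*} [∀ k, MeasurableSpace (Ω k)] {P : ∀ k, Measure (Ω k)}
  {Z : ∀ k, ℕ+ → Ω k → ℝ} {A : ℕ+ → ℕ+ → ℕ+ → ℝ}

lemma tsum_limit_corr_ne_top
    (hconv : ∀ τ : ℕ, TendstoUniformly
      (fun (k : ℕ+) (s : ℕ+) => A k s (shift s τ)) (fun _ => Ainf τ) atTop) {L : ℕ} {c : ℝ≥0∞}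
    (hc : c ≠ ∞) (hL : ∀ᶠ k in atTop, ∑' i, supCorr (A k) (L + i) ≤ c) :
    ∑' τ, ENNReal.ofReal (Ainf τ) ≠ ∞ := by
  have htail : ∑' i, ENNReal.ofReal (Ainf (i + L)) ≤ c := by
    refine ENNReal.tsum_le_of_sum_range_le fun N => ?_
    have hlim : Tendsto (fun k => ∑ i ∈ Finset.range N,
        ENNReal.ofReal (A k 1 (shift 1 (i + L)))) atTop
        (𝓝 (∑ i ∈ Finset.range N, ENNReal.ofReal (Ainf (i + L)))) :=
      tendsto_finsetSum _ fun i _ => (ENNReal.continuous_ofReal.tendsto _).comp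
        ((hconv (i + L)).tendsto_at 1)
    refine le_of_tendsto hlim (hL.mono fun k hk => le_trans ?_ hk)
    calc ∑ i ∈ Finset.range N, ENNReal.ofReal (A k 1 (shift 1 (i + L)))
        ≤ ∑ i ∈ Finset.range N, supCorr (A k) (L + i) := Finset.sum_le_sum fun i _ => by
          rw [add_comm i L]
          exact le_iSup (fun s => ENNReal.ofReal (A k s (shift s (L + i)))) 1
      _ ≤ _ := ENNReal.sum_le_tsum (Finset.range N)
  have hsplit := Summable.sum_add_tsum_nat_add' (f := fun τ => ENNReal.ofReal (Ainf τ)) (k := L)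
    ENNReal.summable
  have hhead : ∑ i ∈ Finset.range L, ENNReal.ofReal (Ainf i) ≠ ∞ :=
    ENNReal.sum_ne_top.2 fun i _ => ENNReal.ofReal_ne_top
  have htail' : ∑' i, ENNReal.ofReal (Ainf (i + L)) ≠ ∞ := ne_top_of_le_ne_top hc htail
  exact hsplit ▸ ENNReal.add_ne_top.2 ⟨hhead, htail'⟩

lemma eventually_abs_orthant_window_sub_lt (hZ : ∀ k, IsCenteredGaussianWithCorr (P k) (Z k) (A k))
    (hZinf : IsStationaryCenteredGaussianWithCorr Pinf Zinf Ainf)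
    (hconv : ∀ τ : ℕ, TendstoUniformly
      (fun (k : ℕ+) (s : ℕ+) => A k s (shift s τ)) (fun _ => Ainf τ) atTop)
    (r : ℝ) (M : ℕ) {ε : ℝ} (hε : 0 < ε) :
    ∀ᶠ k in atTop, ∀ s, |orthant (corrMatrix (A k) (window M s)) (fun _ => r) -
      persistenceProb Pinf Zinf r M| < ε := by
  have hinf : IsCenteredGaussianWithCorr Pinf Zinf _ := hZinf
  rw [hinf.persistenceProb_eq]
  obtain ⟨δ, hδ, hclose⟩ := exists_forall_abs_orthant_sub_lt (hinf.posSemidef (window M 0))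
    (fun i => by rw [corrMatrix_apply, hinf.corr_self]; exact one_pos) (fun _ => r) hε
  have hev : ∀ᶠ k in atTop, ∀ τ ∈ Finset.range M, ∀ s, |A k s (shift s τ) - Ainf τ| < δ := by
    rw [Filter.eventually_all_finset]
    intro τ _
    filter_upwards [Metric.tendstoUniformly_iff.1 (hconv τ) δ hδ] with k hk s
    rw [← Real.dist_eq, dist_comm]
    exact hk s
  filter_upwards [hev] with k hk s
  refine hclose _ ((hZ k).posSemidef _) ?_
  have key : ∀ i j : Fin M, i ≤ j → |corrMatrix (A k) (window M s) i j -
      Ainf (Nat.dist i j)| < δ := by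
    intro i j hij
    have hij' : (i : ℕ) ≤ j := hij
    have hd : Nat.dist (i : ℕ) j < M := by
      simp only [Nat.dist]
      omega
    have hs : shift (window M s i) (Nat.dist (i : ℕ) j) = window M s j := by
      apply PNat.eq
      simp only [shift, window, PNat.mk_coe, Nat.succPNat_coe, Nat.dist]
      omega
    have := hk _ (Finset.mem_range.2 hd) (window M s i)
    rwa [hs] at this
  intro i j
  rw [corrMatrix_window_stationary]
  rcases le_total i j with hij | hij
  · exact key i j hij
  · rw [corrMatrix_apply, (hZ k).corr_comm, Nat.dist_comm]
    exact key j i hij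

/-- The exponential rate of decay of the persistence probabilities. -/
noncomputable def rate (P : Measure Ωinf) (Z : ℕ+ → Ωinf → ℝ) (r : ℝ) : ℝ :=
  ⨆ n : ℕ, Real.log (persistenceProb P Z r (n + 1)) / (n + 1 : ℕ)

lemma bddAbove_rate {A : ℕ+ → ℕ+ → ℝ} (h : IsCenteredGaussianWithCorr Pinf Zinf A) (r : ℝ) :
    BddAbove (Set.range fun n : ℕ =>
      Real.log (persistenceProb Pinf Zinf r (n + 1)) / (n + 1 : ℕ)) :=
  ⟨0, by
    rintro _ ⟨n, rfl⟩
    exact div_nonpos_of_nonpos_of_nonneg (Real.log_nonpos (h.persistenceProb_pos r _).le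
      (h.persistenceProb_le_one r _)) (Nat.cast_nonneg _)⟩

lemma log_persistenceProb_le {A : ℕ+ → ℕ+ → ℝ} (h : IsCenteredGaussianWithCorr Pinf Zinf A)
    (r : ℝ) {n : ℕ} (hn : 0 < n) :
    Real.log (persistenceProb Pinf Zinf r n) ≤ rate Pinf Zinf r * n := by
  obtain ⟨n, rfl⟩ := Nat.exists_eq_succ_of_ne_zero hn.ne'
  rw [← div_le_iff₀ (by exact_mod_cast hn)]
  exact le_ciSup (bddAbove_rate h r) n

lemma rate_nonpos {A : ℕ+ → ℕ+ → ℝ} (h : IsCenteredGaussianWithCorr Pinf Zinf A) (r : ℝ) :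
    rate Pinf Zinf r ≤ 0 :=
  ciSup_le fun _ => div_nonpos_of_nonpos_of_nonneg (Real.log_nonpos
    (h.persistenceProb_pos r _).le (h.persistenceProb_le_one r _)) (Nat.cast_nonneg _)

lemma eventually_le_log_persistenceProb
    (hZ : ∀ k, IsCenteredGaussianWithCorr (P k) (Z k) (A k))
    (hZinf : IsStationaryCenteredGaussianWithCorr Pinf Zinf Ainf)
    (hconv : ∀ τ : ℕ, TendstoUniformly
      (fun (k : ℕ+) (s : ℕ+) => A k s (shift s τ)) (fun _ => Ainf τ) atTop)
    (r : ℝ) {ε : ℝ} (hε : 0 < ε) :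
    ∀ᶠ p : ℕ+ × ℕ in atTop ×ˢ atTop, (p.2 : ℝ) * (rate Pinf Zinf r - ε) ≤
      Real.log (persistenceProb (P p.1) (Z p.1) r p.2) := by
  have hinf : IsCenteredGaussianWithCorr Pinf Zinf _ := hZinf
  obtain ⟨m, hm⟩ := exists_lt_of_lt_ciSup
    (show rate Pinf Zinf r - ε / 3 < rate Pinf Zinf r by linarith)
  obtain ⟨M, hM⟩ : ∃ M, M = m + 1 := ⟨_, rfl⟩
  rw [← hM] at hm
  have hM0 : 0 < M := by omega
  have hM1 : (1 : ℝ) ≤ M := by exact_mod_cast hM0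
  set x := persistenceProb Pinf Zinf r M with hx
  have hx0 : 0 < x := hinf.persistenceProb_pos r M
  set c := x * Real.exp (-(ε / 3)) with hc
  have hc0 : 0 < c := by positivity
  have hcx : c < x := mul_lt_of_lt_one_right hx0 (Real.exp_lt_one_iff.2 (by linarith))
  have hlogc : Real.log c = Real.log x - ε / 3 := by
    rw [hc, Real.log_mul hx0.ne' (Real.exp_ne_zero _), Real.log_exp]; ring
  have hlogc0 : Real.log c ≤ 0 :=
    Real.log_nonpos hc0.le (hcx.le.trans (hinf.persistenceProb_le_one r M))
  have hk := eventually_abs_orthant_window_sub_lt hZ hZinf hconv r M (sub_pos.2 hcx)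
  have hn : ∀ᶠ n : ℕ in atTop, -Real.log c / (ε / 3) ≤ n :=
    tendsto_natCast_atTop_atTop.eventually_ge_atTop _
  filter_upwards [hk.prod_mk hn] with ⟨k, n⟩ ⟨hk, hn⟩
  simp only at hk hn ⊢
  have hpow := (hZ k).pow_le_persistenceProb hM0 hc0.le
    (fun s => by have := (abs_lt.1 (hk s)).1; linarith) n
  have hlog := Real.log_le_log (by positivity) hpow
  rw [Real.log_pow] at hlog
  refine le_trans ?_ hlog
  rw [div_le_iff₀ (by positivity)] at hn
  have h1 : ((n / M + 1 : ℕ) : ℝ) ≤ n / M + 1 := by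
    push_cast
    linarith [Nat.cast_div_le (α := ℝ) (m := n) (n := M)]
  have h2 : (n / M + 1 : ℝ) * Real.log c ≤ ((n / M + 1 : ℕ) : ℝ) * Real.log c :=
    mul_le_mul_of_nonpos_right h1 hlogc0
  have h3 : rate Pinf Zinf r - 2 * (ε / 3) ≤ Real.log c / M := by
    rw [hlogc, sub_div]
    have : ε / 3 / M ≤ ε / 3 := div_le_self (by linarith) hM1
    linarith
  have h4 : (n : ℝ) * (rate Pinf Zinf r - 2 * (ε / 3)) ≤ n * (Real.log c / M) :=
    mul_le_mul_of_nonneg_left h3 (Nat.cast_nonneg n)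
  have h5 : (n / M + 1 : ℝ) * Real.log c = n * (Real.log c / M) + Real.log c := by ring
  linarith

lemma exists_lt_gaussianReal_Iio {c : ℝ} (hc : c < 1) :
    ∃ x, ∀ y, x ≤ y → c < (gaussianReal 0 1).real (Set.Iio y) := by
  obtain ⟨x, hx⟩ := ((tendsto_cdf_atTop (gaussianReal 0 1)).eventually (lt_mem_nhds hc)).exists
  refine ⟨x + 1, fun y hy => hx.trans_le ?_⟩
  rw [cdf_eq_real]
  exact measureReal_mono fun z hz => (Set.mem_Iic.1 hz).trans_lt (by linarith)

/-- The parameters of the decoupling inequality can be chosen to make its cost negligible. -/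
lemma exists_noise_parameters (r : ℝ) {η c : ℝ} (hη : 0 < η) (hc : c < 1) (hc0 : 0 ≤ c) :
    ∃ δ v : ℝ, 0 < δ ∧ δ < v ∧ (r + η) / √(1 + v) ≤ r + 2 * η ∧
      c * c ≤ √((v - δ) / (v + δ)) * (gaussianReal 0 1).real (Set.Iio (η / √(v - δ))) := by
  obtain ⟨x, hx⟩ := exists_lt_gaussianReal_Iio hc
  have h1 : ∀ᶠ v in 𝓝[>] (0 : ℝ), (r + η) / √(1 + v) < r + 2 * η := by
    refine Tendsto.eventually (?_ : Tendsto _ _ (𝓝 (r + η))) (gt_mem_nhds (by linarith))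
    refine Tendsto.mono_left ?_ nhdsWithin_le_nhds
    have : ContinuousAt (fun v : ℝ => (r + η) / √(1 + v)) 0 := by
      refine continuousAt_const.div (by fun_prop) ?_
      simp
    simpa [ContinuousAt] using this
  have h2 : ∀ᶠ v in 𝓝[>] (0 : ℝ), √v * (|x| + 1) < η := by
    refine Tendsto.eventually (?_ : Tendsto _ _ (𝓝 (0 : ℝ))) (gt_mem_nhds hη)
    refine Tendsto.mono_left ?_ nhdsWithin_le_nhds
    have : ContinuousAt (fun v : ℝ => √v * (|x| + 1)) 0 := by fun_prop
    simpa [ContinuousAt] using this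
  obtain ⟨v, ⟨hv1, hv2⟩, hv⟩ := ((h1.and h2).and self_mem_nhdsWithin).exists
  have hv : 0 < v := hv
  have h3 : ∀ᶠ δ in 𝓝[>] (0 : ℝ), c < √((v - δ) / (v + δ)) := by
    refine Tendsto.eventually (?_ : Tendsto _ _ (𝓝 (1 : ℝ))) (lt_mem_nhds hc)
    refine Tendsto.mono_left ?_ nhdsWithin_le_nhds
    have : ContinuousAt (fun δ : ℝ => √((v - δ) / (v + δ))) 0 := by
      refine ContinuousAt.sqrt (ContinuousAt.div (by fun_prop) (by fun_prop) ?_)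
      simpa using hv.ne'
    simpa [ContinuousAt, hv.ne'] using this
  have h4 : ∀ᶠ δ in 𝓝[>] (0 : ℝ), δ < v :=
    nhdsWithin_le_nhds (gt_mem_nhds hv)
  obtain ⟨δ, ⟨hδ3, hδ4⟩, hδ⟩ := ((h3.and h4).and self_mem_nhdsWithin).exists
  have hδ : 0 < δ := hδ
  refine ⟨δ, v, hδ, hδ4, hv1.le, mul_le_mul hδ3.le (hx _ ?_).le hc0 (Real.sqrt_nonneg _)⟩
  have hvd : 0 < √(v - δ) := Real.sqrt_pos.2 (by linarith)
  rw [le_div_iff₀ hvd]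
  calc x * √(v - δ) ≤ (|x| + 1) * √(v - δ) := by
        gcongr
        linarith [le_abs_self x]
    _ ≤ (|x| + 1) * √v := by
        gcongr
        linarith
    _ ≤ η := by linarith

/-- The rate of decay is continuous from the right in the threshold, uniformly in the horizon. -/
lemma exists_log_persistenceProb_add_le
    (hZinf : IsStationaryCenteredGaussianWithCorr Pinf Zinf Ainf)
    (hsum : ∑' τ, ENNReal.ofReal (Ainf τ) ≠ ∞) (r : ℝ) {ε : ℝ} (hε : 0 < ε) :
    ∃ η > 0, ∀ M, 0 < M → Real.log (persistenceProb Pinf Zinf (r + η) M) ≤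
      (rate Pinf Zinf r + ε) * M := by
  have hinf : IsCenteredGaussianWithCorr Pinf Zinf _ := hZinf
  set ρ := rate Pinf Zinf r with hρ
  set B := (2 * ∑' τ, ENNReal.ofReal (Ainf τ)).toReal with hB
  have hB0 : 0 ≤ B := ENNReal.toReal_nonneg
  obtain ⟨q, hq⟩ : ∃ q : ℝ, q = max 2 (-ρ / (ε / 2)) := ⟨_, rfl⟩
  have hq2 : 2 ≤ q := hq ▸ le_max_left _ _
  have hqρ : -ρ / q ≤ ε / 2 := by
    rw [div_le_iff₀ (by linarith), ← div_le_iff₀' (by linarith)]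
    exact hq ▸ le_max_right _ _
  have hpq := (Real.HolderConjugate.conjExponent (by linarith : 1 < q)).symm
  set p := q.conjExponent
  have hp : 1 / p = 1 - 1 / q := by
    have := hpq.inv_add_inv_eq_one
    rw [one_div, one_div]
    linarith
  have hp0 : 0 ≤ 1 / p := by have := hpq.pos; positivity
  have hden : 0 < (q - 1) * (B + 1) := mul_pos (by linarith) (by linarith)
  refine ⟨√(ε / ((q - 1) * (B + 1))), Real.sqrt_pos.2 (div_pos hε hden), fun M hM => ?_⟩
  have hη2 : √(ε / ((q - 1) * (B + 1))) ^ 2 = ε / ((q - 1) * (B + 1)) :=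
    Real.sq_sqrt (div_pos hε hden).le
  set η := √(ε / ((q - 1) * (B + 1)))
  have : Nonempty (Fin M) := ⟨⟨0, hM⟩⟩
  have hM0 : (0 : ℝ) < M := by exact_mod_cast hM
  have key := orthant_add_const_le (hinf.posSemidef (window M 0))
    (fun i => hinf.corr_self _) (fun i j => hinf.nonneg _ _) hpq r (η := η) (Real.sqrt_nonneg _)
  rw [← hinf.persistenceProb_eq, ← hinf.persistenceProb_eq] at key
  have hx0 := hinf.persistenceProb_pos r M
  have hlog := Real.log_le_log (hinf.persistenceProb_pos (r + η) M) key
  rw [Real.log_mul (Real.rpow_pos_of_pos hx0 _).ne' (Real.exp_ne_zero _), Real.log_rpow hx0,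
    Real.log_exp, hη2] at hlog
  have hS := sum_corrMatrix_window_le (fun τ => hZinf.nonneg τ) hsum M
  rw [← hB] at hS
  have h1 : 1 / p * Real.log (persistenceProb Pinf Zinf r M) ≤ 1 / p * (ρ * M) :=
    mul_le_mul_of_nonneg_left (log_persistenceProb_le hinf r hM) hp0
  have h2 : (q - 1) * (ε / ((q - 1) * (B + 1)) * ∑ i, ∑ j,
      corrMatrix (fun s t : ℕ+ => Ainf (Nat.dist (s : ℕ) t)) (window M 0) i j) / 2 ≤
      ε / 2 * M := by
    have hq1 : q - 1 ≠ 0 := by linarith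
    have hB1 : B + 1 ≠ 0 := by linarith
    calc _ ≤ (q - 1) * (ε / ((q - 1) * (B + 1)) * ((B + 1) * M)) / 2 := by
          have : 0 ≤ ε / ((q - 1) * (B + 1)) := (div_pos hε hden).le
          gcongr
          · linarith
          · nlinarith
      _ = ε / 2 * M := by field_simp
  have h3 : 1 / p * (ρ * M) = ρ * M + (-ρ / q) * M := by rw [hp]; ring
  have h4 : (-ρ / q) * M ≤ ε / 2 * M := mul_le_mul_of_nonneg_right hqρ hM0.le
  linarith

lemma eventually_log_persistenceProb_le
    (hZ : ∀ k, IsCenteredGaussianWithCorr (P k) (Z k) (A k))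
    (hZinf : IsStationaryCenteredGaussianWithCorr Pinf Zinf Ainf)
    (hconv : ∀ τ : ℕ, TendstoUniformly
      (fun (k : ℕ+) (s : ℕ+) => A k s (shift s τ)) (fun _ => Ainf τ) atTop)
    (htail : Tendsto
      (fun L : ℕ => limsup (fun k : ℕ+ => ∑' i : ℕ, supCorr (A k) (L + i)) atTop) atTop (𝓝 0))
    (r : ℝ) {ε : ℝ} (hε : 0 < ε) :
    ∀ᶠ p : ℕ+ × ℕ in atTop ×ˢ atTop, Real.log (persistenceProb (P p.1) (Z p.1) r p.2) ≤
      (p.2 : ℝ) * (rate Pinf Zinf r + ε) := by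
  have hinf : IsCenteredGaussianWithCorr Pinf Zinf _ := hZinf
  have hex : ∀ x : ℝ, 0 < x → ∃ L : ℕ, ∀ᶠ k in atTop,
      ∑' i, supCorr (A k) (L + i) ≤ ENNReal.ofReal x := by
    intro x hx
    obtain ⟨L, hL⟩ := (htail.eventually (gt_mem_nhds (ENNReal.ofReal_pos.2 hx))).exists
    exact ⟨L, (eventually_lt_of_limsup_lt hL).mono fun k hk => hk.le⟩
  have hsum : ∑' τ, ENNReal.ofReal (Ainf τ) ≠ ∞ := by
    obtain ⟨L, hL⟩ := hex 1 one_pos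
    exact tsum_limit_corr_ne_top hconv ENNReal.ofReal_ne_top hL
  set ρ := rate Pinf Zinf r with hρ
  have hρ0 : ρ ≤ 0 := rate_nonpos hinf r
  obtain ⟨η', hη', hshift⟩ := exists_log_persistenceProb_add_le hZinf hsum r
    (show 0 < ε / 8 by linarith)
  obtain ⟨δ, v, hδ, hδv, hrv, hcost⟩ := exists_noise_parameters r (half_pos hη')
    (c := Real.exp (-(ε / 8))) (Real.exp_lt_one_iff.2 (by linarith)) (Real.exp_nonneg _)
  rw [mul_div_cancel₀ _ two_ne_zero] at hrv
  rw [← Real.exp_add] at hcost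
  obtain ⟨L, hL⟩ := hex (δ / 2) (by linarith)
  obtain ⟨m, hm⟩ := exists_nat_ge (-ρ * L / (ε / 8))
  obtain ⟨M, hM⟩ : ∃ M, M = m + 1 := ⟨_, rfl⟩
  have hM0 : 0 < M := by omega
  have hM1 : (1 : ℝ) ≤ M := by exact_mod_cast hM0
  have hML : -ρ * L ≤ ε / 8 * M := by
    rw [div_le_iff₀ (by linarith)] at hm
    have : (m : ℝ) ≤ M := by exact_mod_cast (by omega : m ≤ M)
    nlinarith
  set x := persistenceProb Pinf Zinf (r + η') M with hx
  have hx0 : 0 < x := hinf.persistenceProb_pos _ M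
  set c := x * Real.exp (ε / 8) with hc
  have hc0 : 0 < c := by positivity
  have hxc : x < c := lt_mul_of_one_lt_right hx0 (Real.one_lt_exp_iff.2 (by linarith))
  have hlogc : Real.log c ≤ (ρ + ε / 4) * M := by
    rw [hc, Real.log_mul hx0.ne' (Real.exp_ne_zero _), Real.log_exp]
    nlinarith [hshift M hM0]
  have hk := eventually_abs_orthant_window_sub_lt hZ hZinf hconv (r + η') M (sub_pos.2 hxc)
  have hn : ∀ᶠ n : ℕ in atTop, -ρ * (M + L) / (ε / 8) ≤ n :=
    tendsto_natCast_atTop_atTop.eventually_ge_atTop _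
  filter_upwards [(hk.and hL).prod_mk hn] with ⟨k, n⟩ ⟨⟨hk, hLk⟩, hn⟩
  simp only at hk hLk hn ⊢
  rw [div_le_iff₀ (by linarith)] at hn
  obtain ⟨q, hq⟩ : ∃ q, q = n / (M + L) := ⟨_, rfl⟩
  have hqn : q * (M + L) ≤ n := hq ▸ Nat.div_mul_le_self n (M + L)
  have hnq : n ≤ q * (M + L) + (M + L) := by
    have := Nat.div_add_mod n (M + L)
    have h2 := Nat.mod_lt n (show 0 < M + L by omega)
    rw [← hq, mul_comm] at this
    omega
  have hdec := (hZ k).persistenceProb_mul_pow_le hδv hδ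
    (sum_corr_le_of_tsum_le (hZ k).corr_comm (hZ k).nonneg hδ.le hLk) hrv
    (fun s => by have := (abs_lt.1 (hk s)).2; linarith : ∀ s, _ ≤ c) hqn
  have hp0 := (hZ k).persistenceProb_pos r n
  have hdec' : persistenceProb (P k) (Z k) r n *
      Real.exp (-(ε / 8) + -(ε / 8)) ^ (q * M) ≤ c ^ q :=
    (mul_le_mul_of_nonneg_left (pow_le_pow_left₀ (Real.exp_nonneg _) hcost _) hp0.le).trans hdec
  have hlog := Real.log_le_log (by positivity) hdec'
  rw [Real.log_mul hp0.ne' (by positivity), Real.log_pow, Real.log_pow, Real.log_exp] at hlog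
  push_cast at hlog
  have hqn' : (q : ℝ) * (M + L) ≤ n := by exact_mod_cast hqn
  have hnq' : (n : ℝ) ≤ q * (M + L) + (M + L) := by exact_mod_cast hnq
  have hq0 : (0 : ℝ) ≤ q := Nat.cast_nonneg q
  have hL0 : (0 : ℝ) ≤ q * L := by positivity
  have hqM : (q : ℝ) * M ≤ n := by linarith
  have e1 : (q : ℝ) * Real.log c ≤ q * ((ρ + ε / 4) * M) := mul_le_mul_of_nonneg_left hlogc hq0
  have e2 : (q : ℝ) * (-ρ * L) ≤ q * (ε / 8 * M) := mul_le_mul_of_nonneg_left hML hq0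
  have e3 : ρ * (q * (M + L) + (M + L)) ≤ ρ * n := mul_le_mul_of_nonpos_left hnq' hρ0
  have e4 : ε * (q * M) ≤ ε * n := mul_le_mul_of_nonneg_left hqM hε.le
  have e5 : 0 ≤ ε * n := by positivity
  linarith

end Stationary

end Persistence

theorem lemma3p4
    {Ω : ℕ+ → Type*} [∀ k, MeasurableSpace (Ω k)] (P : ∀ k, Measure (Ω k))
    (Z : ∀ k, ℕ+ → Ω k → ℝ) (A : ℕ+ → ℕ+ → ℕ+ → ℝ)
    {Ωinf : Type*} [MeasurableSpace Ωinf] (Pinf : Measure Ωinf)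
    (Zinf : ℕ+ → Ωinf → ℝ) (Ainf : ℕ → ℝ)
    (hZ : ∀ k, Persistence.IsCenteredGaussianWithCorr (P k) (Z k) (A k))
    (hZinf : Persistence.IsStationaryCenteredGaussianWithCorr Pinf Zinf Ainf)
    (hconv : ∀ τ : ℕ, TendstoUniformly
      (fun (k : ℕ+) (s : ℕ+) => A k s (Persistence.shift s τ)) (fun _ => Ainf τ) atTop)
    (htail : Tendsto
      (fun L : ℕ => limsup (fun k : ℕ+ => ∑' i : ℕ, Persistence.supCorr (A k) (L + i)) atTop)
      atTop (𝓝 0))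
    (r : ℝ) :
    (∀ k n, 0 < Persistence.persistenceProb (P k) (Z k) r n) ∧
    (∀ n, 0 < Persistence.persistenceProb Pinf Zinf r n) ∧
    Tendsto
      (fun p : ℕ+ × ℕ => 1 / (p.2 : ℝ) *
        |Real.log (Persistence.persistenceProb (P p.1) (Z p.1) r p.2) -
          Real.log (Persistence.persistenceProb Pinf Zinf r p.2)|)
      (atTop ×ˢ atTop) (𝓝 0) := by
  have hinf : Persistence.IsCenteredGaussianWithCorr Pinf Zinf _ := hZinf
  refine ⟨fun k n => (hZ k).persistenceProb_pos r n, fun n => hinf.persistenceProb_pos r n, ?_⟩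
  have hconst : ∀ τ : ℕ, TendstoUniformly (fun (_ : ℕ+) (s : ℕ+) =>
      (fun s t : ℕ+ => Ainf (Nat.dist (s : ℕ) t)) s (Persistence.shift s τ))
      (fun _ => Ainf τ) atTop := by
    intro τ
    rw [Metric.tendstoUniformly_iff]
    refine fun ε hε => .of_forall fun _ s => ?_
    have hd : Nat.dist (s : ℕ) (Persistence.shift s τ : ℕ+) = τ := by
      simp only [Persistence.shift, PNat.mk_coe, Nat.dist]
      omega
    simpa only [hd, dist_self] using hε
  rw [Metric.tendsto_nhds]
  intro ε hε
  have hε3 : 0 < ε / 3 := by linarith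
  filter_upwards [Persistence.eventually_le_log_persistenceProb hZ hZinf hconv r hε3,
    Persistence.eventually_log_persistenceProb_le hZ hZinf hconv htail r hε3,
    Persistence.eventually_le_log_persistenceProb (fun _ => hinf) hZinf hconst r hε3,
    (eventually_gt_atTop 0).prod_inr atTop] with ⟨k, n⟩ h1 h2 h3 hn
  simp only at h1 h2 h3 hn ⊢
  have h4 := Persistence.log_persistenceProb_le hinf r hn
  have hn0 : (0 : ℝ) < n := by exact_mod_cast hn
  have hnε : 0 < (n : ℝ) * ε := by positivity
  rw [Real.dist_eq, sub_zero, abs_of_nonneg (by positivity), one_div, inv_mul_lt_iff₀ hn0, abs_lt]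
  constructor <;> linarith
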